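/- **Model.** Let $N_a\ge 1$ agents form opinions on $N_o\ge 2$ options; $z_{ij}\in\mathbb R$ is the opinion of agent $i$ on option $j$, $\mathbf Z_i=(z_{i1},\dots,z_{iN_o})\in \mathbf 1^\perp\subset\mathbb R^{N_o}$, and the state space is $V=(\mathbf 1^{\perp})^{N_a}$. Let $P_0=I-\frac1{N_o}\mathbf 1\mathbf 1^T$ and consider, for parameters $d>0$, $u\ge 0$, $\alpha,\beta,\gamma,\delta\in\mathbb R$, the homogeneous opinion dynamics on $V$ $$\dot{\mathbf Z}_i=P_0\mathbf F_i(\mathbf Z),\qquad F_{ij}(\mathbf Z)=-d\,z_{ij}+u\Big(S_1\big(\alpha z_{ij}+\gamma\sum_{k\ne i}a_{ik}z_{kj}\big)+\sum_{l\neq j}S_2\big(\beta z_{il}+\delta\sum_{k\neq i}a_{ik}z_{kl}\big)\Big).$$ Here $A=[a_{ik}]$ with $a_{ik}\in\{0,1\}$, $a_{ii}=0$, is the adjacency matrix of a strongly connected directed graph, and $S_q:\mathbb R\to[-k_{q1},k_{q2}]$ ($k_{q1},k_{q2}>0$, $q=1,2$) are $C^3$ saturating functions with $S_q(0)=0$,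 $S_q'(0)=1$, $S_q''(0)\ne0$, $S_q'''(0)\neq 0$. **Terminology.** A state is an *agreement* state if $\operatorname{sign}(z_{ij})=\operatorname{sign}(z_{kj})$ for all agents $i,k$ and all options $j$, and a *disagreement* state if $\operatorname{sign}(z_{ij})\ne\operatorname{sign}(z_{kj})$ for some agents $i\neq k$ and some option $j$. A *bifurcation branch* at $u^*$ is a continuous curve $s\mapsto(u(s),\mathbf Z(s))$, $0\le s<s_0$, starting at $(u^*,0)$, such that for $s>0$ the state $\mathbf Z(s)\in V$ is a nonzero equilibrium of the dynamics with $u=u(s)$. We say that *the neutral point undergoes a steady-state bifurcation at $u^*$ along $\mathbb R\{\mathbf v\}\otimes\mathbf 1^\perp$* if: (i) $\mathbf Z=0$ is locally exponentially stable for $0<u<u^*$ and unstable for $u>u^*$; (ii) at $u=u^*$ the kernel of the Jacobian at $\mathbf Z=0$ (on $V$) is $\mathbb R\{\mathbf v\}\otimes\mathbf 1^\perp$; (iii) there are $0\neq\mathbf v_{ax}\in\mathbf 1^\perp$ and a bifurcation branch at $u^*$ with tangent vector $\mathbf v\otimes\mathbf v_{ax}$ at $\mathbf Z=0$; (iv)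 all equilibria near $(u^*,0)$ are tangent to the kernel: for every $\eta>0$, every equilibrium $\mathbf Z\in V$ for a parameter $u$, with $(u,\mathbf Z)$ sufficiently close to $(u^*,0)$, satisfies $\|\mathbf Z-\mathbf v\otimes\mathbf w\|\le\eta\|\mathbf Z\|$ for some $\mathbf w\in\mathbf 1^\perp$. *Close to bifurcation all branches are made of* states of some kind if there is a neighbourhood of $(u^*,0)$ in which all nonzero equilibria are of that kind; in particular each bifurcation branch at $u^*$ consists of such states for all small $s>0$. **A. Cooperative agents.** Let $\lambda_{max}$ be the largest real part of the eigenvalues of $A$. Suppose $\gamma-\delta>0$ and $\alpha-\beta+\lambda_{max}(\gamma-\delta)>0$. Then $\lambda_{max}$ is an eigenvalue of $A$ with an entrywise positive eigenvector $\mathbf v_{max}$, and the neutral point undergoes a steady-state bifurcation along $\mathbb R\{\mathbf v_{max}\}\otimes\mathbf 1^\perp$ at $$u_a=\frac{d}{\alpha-\beta+\lambda_{max}(\gamma-\delta)}.$$ Moreover, if $N_o=2$, or if the genericity condition $S_1''(0)(\alpha+\gamma\lambda_{max})^2\neq S_2''(0)(\beta+\delta\lambda_{max})^2$ holds, then close to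 bifurcation all branches are made of agreement states. **B. Competitive agents.** Let $\lambda_{min}$ be the smallest real part of the eigenvalues of $A$. Assume that $\lambda_{min}$ is itself an eigenvalue of $A$, that it is (algebraically) simple, and that $\operatorname{Re}\xi\ne\lambda_{min}$ for all eigenvalues $\xi\neq\lambda_{min}$ of $A$; let $\mathbf v_{min}$ be an associated real eigenvector. Suppose $\gamma-\delta<0$ and $\alpha-\beta+\lambda_{min}(\gamma-\delta)>0$. Then the neutral point undergoes a steady-state bifurcation along $\mathbb R\{\mathbf v_{min}\}\otimes\mathbf 1^\perp$ at $$u_d=\frac{d}{\alpha-\beta+\lambda_{min}(\gamma-\delta)}.$$ Moreover, whenever $\mathbf v_{min}$ has both positive and negative entries, close to bifurcation all branches are made of disagreement states. -/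

import Mathlib

open scoped Topology Matrix

namespace OpinionDynamics

noncomputable section

/-- Opinions of `Na` agents about `No` options: `Z i j` is the opinion of agent `i` on option `j`. -/
abbrev State (Na No : ℕ) : Type := Fin Na → Fin No → ℝ

/-- The orthogonal complement of the all-ones vector in the space of options. -/
def optionSpace (No : ℕ) : Submodule ℝ (Fin No → ℝ) where
  carrier := {w | ∑ j, w j = 0}
  zero_mem' := by simp
  add_mem' := by
    intro a b ha hb
    simp only [Set.mem_ofPred_eq] at ha hb ⊢
    simp [Finset.sum_add_distrib, ha, hb]
  smul_mem' := by
    intro c a ha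
    simp only [Set.mem_ofPred_eq] at ha ⊢
    simp [← Finset.mul_sum, ha]

/-- The state space `V`: every agent's opinion vector is orthogonal to the all-ones vector. -/
def stateSpace (Na No : ℕ) : Set (State Na No) := {Z | ∀ i, Z i ∈ optionSpace No}

/-- The orthogonal projection onto `optionSpace No`, i.e. the matrix `I - (1 / No) 1 1ᵀ`. -/
def P0 {No : ℕ} (y : Fin No → ℝ) : Fin No → ℝ := fun j => y j - (1 / (No : ℝ)) * ∑ l, y l

/-- The vector `v ⊗ w`. -/
def tensor {Na No : ℕ} (v : Fin Na → ℝ) (w : Fin No → ℝ) : State Na No := fun i j => v i * w j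

/-- Saturating functions with values in `[-k₁, k₂]`. Monotonicity is not demanded. -/
structure IsSaturating (S : ℝ → ℝ) : Prop where
  contDiff : ContDiff ℝ 3 S
  bounded : ∃ k₁ k₂ : ℝ, 0 < k₁ ∧ 0 < k₂ ∧ ∀ x, S x ∈ Set.Icc (-k₁) k₂
  map_zero : S 0 = 0
  deriv_zero : deriv S 0 = 1
  deriv2_ne : iteratedDeriv 2 S 0 ≠ 0
  deriv3_ne : iteratedDeriv 3 S 0 ≠ 0

/-- Parameters of the general model: resistance `d`, attention `u`, inputs `b`, intra-agent gains
`α` (same option) and `β` (inter-option), inter-agent gains `Γ` (same option) and `Δ`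
(inter-option). -/
structure Params (Na No : ℕ) where
  d : Fin Na → ℝ
  u : Fin Na → ℝ
  b : Fin Na → Fin No → ℝ
  α : Fin Na → ℝ
  β : Fin Na → ℝ
  Γ : Matrix (Fin Na) (Fin Na) ℝ
  Δ : Matrix (Fin Na) (Fin Na) ℝ

/-- The unprojected drive `F i j`. -/
def drive {Na No : ℕ} (S₁ S₂ : ℝ → ℝ) (p : Params Na No) (Z : State Na No) : State Na No :=
  fun i j =>
    -(p.d i) * Z i j + p.b i j +
      p.u i * (S₁ (p.α i * Z i j + ∑ k ∈ Finset.univ.erase i, p.Γ i k * Z k j) +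
        ∑ l ∈ Finset.univ.erase j,
          S₂ (p.β i * Z i l + ∑ k ∈ Finset.univ.erase i, p.Δ i k * Z k l))

/-- The vector field of the opinion dynamics: `dZ i / dt = P0 (F i (Z))`. -/
def vectorField {Na No : ℕ} (S₁ S₂ : ℝ → ℝ) (p : Params Na No) (Z : State Na No) : State Na No :=
  fun i => P0 (drive S₁ S₂ p Z i)

/-- The homogeneous regime without inputs, on the network with adjacency matrix `A`. -/
def homogeneous (Na No : ℕ) (A : Matrix (Fin Na) (Fin Na) ℝ) (d α β γ δ u : ℝ) :
    Params Na No where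
  d := fun _ => d
  u := fun _ => u
  b := fun _ _ => 0
  α := fun _ => α
  β := fun _ => β
  Γ := γ • A
  Δ := δ • A

/-- The homogeneous opinion dynamics as a family of vector fields indexed by the attention `u`. -/
def homField {Na No : ℕ} (S₁ S₂ : ℝ → ℝ) (A : Matrix (Fin Na) (Fin Na) ℝ) (d α β γ δ : ℝ)
    (u : ℝ) : State Na No → State Na No :=
  vectorField S₁ S₂ (homogeneous Na No A d α β γ δ u)

/-- Unweighted adjacency matrices without self-loops. -/
structure IsAdjacency {Na : ℕ} (A : Matrix (Fin Na) (Fin Na) ℝ) : Prop where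
  zero_or_one : ∀ i k, A i k = 0 ∨ A i k = 1
  diag : ∀ i, A i i = 0

/-- The directed graph with an edge from `i` to `k` whenever `A i k ≠ 0` is strongly connected. -/
def StronglyConnected {Na : ℕ} (A : Matrix (Fin Na) (Fin Na) ℝ) : Prop :=
  ∀ i k, Relation.ReflTransGen (fun i k => A i k ≠ 0) i k

/-- The complex eigenvalues of a real matrix. -/
def eigenvalues {Na : ℕ} (A : Matrix (Fin Na) (Fin Na) ℝ) : Set ℂ :=
  spectrum ℂ (A.map (algebraMap ℝ ℂ))

/-- The real parts of the eigenvalues of a real matrix. -/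
def realParts {Na : ℕ} (A : Matrix (Fin Na) (Fin Na) ℝ) : Set ℝ := Complex.re '' eigenvalues A

/-- Agreement: all agents have the same sign of opinion on each option. -/
def IsAgreement {Na No : ℕ} (Z : State Na No) : Prop :=
  ∀ i k j, SignType.sign (Z i j) = SignType.sign (Z k j)

/-- Disagreement: two agents have different signs of opinion on some option. -/
def IsDisagreement {Na No : ℕ} (Z : State Na No) : Prop :=
  ∃ i k, i ≠ k ∧ ∃ j, SignType.sign (Z i j) ≠ SignType.sign (Z k j)

/-- `Z` solves `dZ/dt = f Z` in the state space on the time interval `[0, T]`. -/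
def IsSolution {Na No : ℕ} (f : State Na No → State Na No) (T : ℝ) (Z : ℝ → State Na No) : Prop :=
  ∀ t ∈ Set.Icc 0 T, Z t ∈ stateSpace Na No ∧ HasDerivWithinAt Z (f (Z t)) (Set.Icc 0 T) t

/-- Local exponential stability of the neutral point. -/
def LocallyExpStable {Na No : ℕ} (f : State Na No → State Na No) : Prop :=
  ∃ ρ M κ : ℝ, 0 < ρ ∧ 0 < M ∧ 0 < κ ∧
    ∀ (T : ℝ) (Z : ℝ → State Na No), 0 < T → IsSolution f T Z → ‖Z 0‖ < ρ →
      ∀ t ∈ Set.Icc 0 T, ‖Z t‖ ≤ M * Real.exp (-κ * t) * ‖Z 0‖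

/-- Lyapunov stability of the neutral point. -/
def LyapunovStable {Na No : ℕ} (f : State Na No → State Na No) : Prop :=
  ∀ ε > 0, ∃ ρ > 0, ∀ (T : ℝ) (Z : ℝ → State Na No), 0 < T → IsSolution f T Z → ‖Z 0‖ < ρ →
    ∀ t ∈ Set.Icc 0 T, ‖Z t‖ < ε

/-- Equilibria in the state space. -/
def IsEquilibrium {Na No : ℕ} (f : State Na No → State Na No) (Z : State Na No) : Prop :=
  Z ∈ stateSpace Na No ∧ f Z = 0

/-- A bifurcation branch of the family `f` at the neutral point and the parameter value `ustar`:
a curve `s ↦ (U s, Z s)`, `0 ≤ s < s₀`, that starts at `(ustar, 0)` and consists of nonzero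
equilibria for `s > 0`. -/
structure IsBranch {Na No : ℕ} (f : ℝ → State Na No → State Na No) (ustar s₀ : ℝ)
    (U : ℝ → ℝ) (Z : ℝ → State Na No) : Prop where
  pos : 0 < s₀
  contU : ContinuousOn U (Set.Ico 0 s₀)
  contZ : ContinuousOn Z (Set.Ico 0 s₀)
  startU : U 0 = ustar
  startZ : Z 0 = 0
  equilibrium : ∀ s ∈ Set.Ioo 0 s₀, Z s ≠ 0 ∧ IsEquilibrium (f (U s)) (Z s)

/-- The neutral point loses stability at the critical parameter value `ustar` in a steady-state
bifurcation along the kernel `ℝ v ⊗ 1ᗮ` of the Jacobian. -/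
structure SteadyStateBifurcation {Na No : ℕ} (f : ℝ → State Na No → State Na No) (ustar : ℝ)
    (v : Fin Na → ℝ) : Prop where
  /-- The neutral point is locally exponentially stable below the critical value. -/
  stable : ∀ u, 0 < u → u < ustar → LocallyExpStable (f u)
  /-- The neutral point is unstable above the critical value. -/
  unstable : ∀ u, ustar < u → ¬ LyapunovStable (f u)
  /-- The Jacobian on the state space at the critical value has kernel `ℝ v ⊗ 1ᗮ`. -/
  kernel : ∀ Y ∈ stateSpace Na No,
    fderiv ℝ (f ustar) 0 Y = 0 ↔ ∃ w ∈ optionSpace No, Y = tensor v w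
  /-- Nonzero equilibria branch off, tangent to a line in the kernel. -/
  branch : ∃ w ∈ optionSpace No, w ≠ 0 ∧ ∃ s₀ U Z, IsBranch f ustar s₀ U Z ∧
    HasDerivWithinAt Z (tensor v w) (Set.Ici 0) 0
  /-- All equilibria that branch off are tangent to the kernel. -/
  tangent : ∀ η > 0, ∃ ε > 0, ∀ u Z, |u - ustar| < ε → ‖Z‖ < ε → IsEquilibrium (f u) Z →
    ∃ w ∈ optionSpace No, ‖Z - tensor v w‖ ≤ η * ‖Z‖

/-- Close to the bifurcation point `(ustar, 0)` all bifurcation branches consist of states with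
property `P`: this holds along each branch, and uniformly, for all nonzero equilibria in a
neighbourhood of the bifurcation point. -/
def NearbyBranches {Na No : ℕ} (P : State Na No → Prop) (f : ℝ → State Na No → State Na No)
    (ustar : ℝ) : Prop :=
  (∀ s₀ U Z, IsBranch f ustar s₀ U Z → ∀ᶠ s in 𝓝[>] (0 : ℝ), P (Z s)) ∧
  ∃ ε > 0, ∀ u Z, |u - ustar| < ε → ‖Z‖ < ε → Z ≠ 0 → IsEquilibrium (f u) Z → P Z

end

end OpinionDynamics

open OpinionDynamics

namespace OpinionDynamics

/-! On the state space the sum over the other options can be replaced by minus the option's own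
term, because the full sum is constant in the option and `P0` kills it (`homField_eq_field`). The
dynamics becomes the projection of `-d Z + u (S₁(P Z) - S₂(Q Z))` with `P = α + γ A` and `Q = β + δ
A` acting on the agents' index. Its Jacobian on the state space is `-d + u (P - Q)`, where `P - Q =
(α - β) + (γ - δ) A`. The sign of `γ - δ` decides which end of the spectrum of `A` gives the
spectral abscissa `c` of `P - Q`; stability is lost at `u = d / c`.

In both regimes the critical eigenspace is a line `ℝ v`, with a left eigenvector `ℓ` normalized by
`ℓ ⬝ᵥ v = 1`. Cooperation gets these from Perron–Frobenius (`exists_perron_vectors`), competition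
from algebraic simplicity (`exists_left_eigenvector_of_simple`). Everything in
`steadyStateBifurcation_field` uses only this pair and the bound on the real parts.

Stability and instability come from a seminorm adapted to the spectral abscissa
(`exists_seminorm_euler_step_le`), compared along solutions with scalar barriers. For the branch,
the options are taken proportional to one axial vector, which leaves one scalar per agent; dividing
the equilibrium equation by the amplitude and applying the inverse function theorem gives a curve of
nonzero equilibria (`exists_branch`). Tangency follows because at an equilibrium the critical
Jacobian applied to `Z` is `o(‖Z‖)`, which controls the component of `Z` off the kernel
(`exists_norm_sub_tensor_coord_le`).

Thus nearby equilibria satisfy `Z = v ⊗ w + o(‖Z‖)`, where `w = coord ℓ Z` has some entry of order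
`‖Z‖`. If `v` has entries of both signs, that entry already exhibits disagreement. If `v` is
positive, agreement needs every entry of `w` to be of order `‖Z‖`. For two options this is clear,
since `w = (t, -t)`. In general, pairing with `ℓ` gives `σ w + k P0 (w ^ 2) ≈ 0` up to `o(‖Z‖ ^ 2)`
(`reduced_equation`), with `k ≠ 0` by genericity; an entry `w j` near zero would force the mean of
`w ^ 2` to be near zero (`le_abs_of_approx_quadratic`). -/

/-! ### Matrices acting on the agents' index -/

/-- The action of a matrix on the agents' index of a state. -/
def act {Na No : ℕ} (M : Matrix (Fin Na) (Fin Na) ℝ) : State Na No →ₗ[ℝ] State Na No where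
  toFun Z := fun i j => ∑ k, M i k * Z k j
  map_add' Y Z := by
    ext i j
    simp [mul_add, Finset.sum_add_distrib]
  map_smul' c Z := by
    ext i j
    simp only [Pi.smul_apply, smul_eq_mul, RingHom.id_apply, Finset.mul_sum]
    exact Finset.sum_congr rfl fun k _ => by ring

lemma act_apply {Na No : ℕ} (M : Matrix (Fin Na) (Fin Na) ℝ) (Z : State Na No) (i j) :
    act M Z i j = ∑ k, M i k * Z k j := rfl

lemma act_apply_eq_mulVec {Na No : ℕ} (M : Matrix (Fin Na) (Fin Na) ℝ) (Z : State Na No) (i j) :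
    act M Z i j = (M *ᵥ fun k => Z k j) i := rfl

lemma act_mul {Na No : ℕ} (M M' : Matrix (Fin Na) (Fin Na) ℝ) (Z : State Na No) :
    act (M * M') Z = act M (act M' Z) := by
  ext i j
  exact (congrFun (Matrix.mulVec_mulVec (fun k => Z k j) M M') i).symm

lemma act_one {Na No : ℕ} (Z : State Na No) : act 1 Z = Z := by
  ext i j
  simp [act_apply_eq_mulVec]

lemma act_add {Na No : ℕ} (M M' : Matrix (Fin Na) (Fin Na) ℝ) (Z : State Na No) :
    act (M + M') Z = act M Z + act M' Z := by
  ext i j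
  simp [act_apply_eq_mulVec, Matrix.add_mulVec]

lemma act_sub {Na No : ℕ} (M M' : Matrix (Fin Na) (Fin Na) ℝ) (Z : State Na No) :
    act (M - M') Z = act M Z - act M' Z := by
  ext i j
  simp [act_apply_eq_mulVec, Matrix.sub_mulVec]

lemma act_smul {Na No : ℕ} (c : ℝ) (M : Matrix (Fin Na) (Fin Na) ℝ) (Z : State Na No) :
    act (c • M) Z = c • act M Z := by
  ext i j
  simp [act_apply_eq_mulVec, Matrix.smul_mulVec]

lemma act_tensor {Na No : ℕ} {M : Matrix (Fin Na) (Fin Na) ℝ} {v : Fin Na → ℝ} {c : ℝ}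
    (h : M *ᵥ v = c • v) (w : Fin No → ℝ) : act M (tensor v w) = c • tensor v w := by
  ext i j
  have hi : ∑ k, M i k * v k = c * v i := congrFun h i
  simp only [act_apply, tensor, Pi.smul_apply, smul_eq_mul, ← mul_assoc, ← Finset.sum_mul, hi]

/-! ### Seminorms adapted to spectral bounds -/

section LinftyNorm

attribute [local instance] Matrix.linftyOpNormedRing Matrix.linftyOpNormedAlgebra

lemma norm_act_le_linftyOpNorm {Na No : ℕ} (M : Matrix (Fin Na) (Fin Na) ℝ) (Z : State Na No) :
    ‖act M Z‖ ≤ ‖M‖ * ‖Z‖ := by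
  have h0 : 0 ≤ ‖M‖ * ‖Z‖ := by positivity
  rw [pi_norm_le_iff_of_nonneg h0]
  intro i
  rw [pi_norm_le_iff_of_nonneg h0]
  intro j
  rw [act_apply_eq_mulVec]
  calc _ ≤ ‖M *ᵥ fun k => Z k j‖ := norm_le_pi_norm _ i
    _ ≤ ‖M‖ * ‖fun k => Z k j‖ := Matrix.linfty_opNorm_mulVec _ _
    _ ≤ _ := by
      gcongr
      rw [pi_norm_le_iff_of_nonneg (norm_nonneg _)]
      exact fun k => (norm_le_pi_norm (Z k) j).trans (norm_le_pi_norm Z k)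

lemma exists_norm_act_le {Na No : ℕ} (M : Matrix (Fin Na) (Fin Na) ℝ) :
    ∃ C, 0 < C ∧ ∀ Z : State Na No, ‖act M Z‖ ≤ C * ‖Z‖ :=
  ⟨‖M‖ + 1, by positivity, fun Z => (norm_act_le_linftyOpNorm M Z).trans <| by
    gcongr; linarith⟩

/-- If the `m`-th power of `M` is a contraction by the factor `ρ ^ m`, then `M` itself contracts
an equivalent seminorm by the factor `ρ`. -/
lemma exists_seminorm_act_le {Na No : ℕ} (M : Matrix (Fin Na) (Fin Na) ℝ) {ρ : ℝ} (hρ : 0 < ρ)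
    (m : ℕ) (hM : ‖M ^ (m + 1)‖ ≤ ρ ^ (m + 1)) :
    ∃ (N : Seminorm ℝ (State Na No)) (a C : ℝ), 0 < a ∧ 0 < C ∧ (∀ Z, a * ‖Z‖ ≤ N Z) ∧
      (∀ Z, N Z ≤ C * ‖Z‖) ∧ ∀ Z, N (act M Z) ≤ ρ * N Z := by
  -- The weights `ρ ^ (m - k)` make the sum telescope: applying `M` shifts `k` to `k + 1`, which
  -- costs exactly one factor `ρ`.
  let N : Seminorm ℝ (State Na No) := Seminorm.of
    (fun Z => ∑ k ∈ Finset.range (m + 1), ρ ^ (m - k) * ‖act (M ^ k) Z‖)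
    (fun Y Z => by
      rw [← Finset.sum_add_distrib]
      refine Finset.sum_le_sum fun k _ => ?_
      rw [map_add, ← mul_add]
      gcongr
      exact norm_add_le _ _)
    (fun r Z => by
      rw [Finset.mul_sum]
      refine Finset.sum_congr rfl fun k _ => ?_
      rw [map_smul, norm_smul]
      ring)
  have hN : ∀ Z, N Z = ∑ k ∈ Finset.range (m + 1), ρ ^ (m - k) * ‖act (M ^ k) Z‖ := fun Z => rfl
  refine ⟨N, ρ ^ m, ∑ k ∈ Finset.range (m + 1), ρ ^ (m - k) * ‖M ^ k‖ + 1, by positivity,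
    by positivity, fun Z => ?_, fun Z => ?_, fun Z => ?_⟩
  · rw [hN, Finset.sum_range_succ', pow_zero, act_one, Nat.sub_zero]
    have : 0 ≤ ∑ k ∈ Finset.range m, ρ ^ (m - (k + 1)) * ‖act (M ^ (k + 1)) Z‖ := by positivity
    linarith
  · rw [hN, add_mul, Finset.sum_mul]
    have : ∑ k ∈ Finset.range (m + 1), ρ ^ (m - k) * ‖act (M ^ k) Z‖ ≤
        ∑ k ∈ Finset.range (m + 1), ρ ^ (m - k) * ‖M ^ k‖ * ‖Z‖ := by
      refine Finset.sum_le_sum fun k _ => ?_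
      rw [mul_assoc]
      gcongr
      exact norm_act_le_linftyOpNorm _ _
    have := norm_nonneg Z
    linarith
  -- The terms agree after the shift, except that the last one on the left, with `M ^ (m + 1)`, is
  -- absorbed by the `k = 0` term on the right through `hM`.
  · rw [hN, hN, Finset.sum_range_succ, Finset.sum_range_succ', mul_add, Finset.mul_sum]
    refine add_le_add (le_of_eq (Finset.sum_congr rfl fun k hk => ?_)) ?_
    · have hk' : m - k = (m - (k + 1)) + 1 := by
        have := Finset.mem_range.1 hk
        omega
      rw [hk', pow_succ ρ, ← act_mul, ← pow_succ M]
      ring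
    · rw [← act_mul, ← pow_succ M, pow_zero, act_one, Nat.sub_self, Nat.sub_zero, pow_zero, one_mul]
      calc _ ≤ ‖M ^ (m + 1)‖ * ‖Z‖ := norm_act_le_linftyOpNorm _ _
        _ ≤ ρ ^ (m + 1) * ‖Z‖ := by gcongr
        _ = _ := by ring

lemma norm_map_algebraMap {n : ℕ} (M : Matrix (Fin n) (Fin n) ℝ) :
    ‖M.map (algebraMap ℝ ℂ)‖ = ‖M‖ := by
  simp [Matrix.linfty_opNorm_def]

lemma map_algebraMap_pow {n : ℕ} (M : Matrix (Fin n) (Fin n) ℝ) (k : ℕ) :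
    (M ^ k).map (algebraMap ℝ ℂ) = M.map (algebraMap ℝ ℂ) ^ k :=
  map_pow (algebraMap ℝ ℂ).mapMatrix M k

/-- Gelfand's formula: the roots `‖M ^ m‖ ^ (1 / m)` converge to the spectral radius, which is below
`ρ`, so some positive power already satisfies the bound. -/
lemma exists_norm_pow_le_of_eigenvalues {n : ℕ} (M : Matrix (Fin n) (Fin n) ℝ) {ρ : ℝ}
    (hρ : 0 < ρ) (hM : ∀ ξ ∈ eigenvalues M, ‖ξ‖ < ρ) :
    ∃ m : ℕ, ‖M ^ (m + 1)‖ ≤ ρ ^ (m + 1) := by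
  rcases isEmpty_or_nonempty (Fin n) with hn | hn
  · refine ⟨0, ?_⟩
    rw [Subsingleton.elim (M ^ (0 + 1)) 0, norm_zero]
    positivity
  have hr : spectralRadius ℂ (M.map (algebraMap ℝ ℂ)) < (ρ.toNNReal : NNReal) := by
    refine spectrum.spectralRadius_lt_of_forall_lt _ fun ξ hξ => ?_
    rw [← NNReal.coe_lt_coe, coe_nnnorm, Real.coe_toNNReal _ hρ.le]
    exact hM ξ hξ
  have ht := spectrum.pow_nnnorm_pow_one_div_tendsto_nhds_spectralRadius (M.map (algebraMap ℝ ℂ))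
  obtain ⟨m, hm, hm1⟩ := ((ht.eventually_lt_const hr).and
    (Filter.eventually_ge_atTop 1)).exists
  obtain ⟨m, rfl⟩ : ∃ k, m = k + 1 := ⟨m - 1, by omega⟩
  refine ⟨m, ?_⟩
  rw [← norm_map_algebraMap, map_algebraMap_pow]
  have h1 : (‖M.map (algebraMap ℝ ℂ) ^ (m + 1)‖₊ : ENNReal) ≤
      ((ρ.toNNReal : NNReal) : ENNReal) ^ (m + 1) := by
    have h2 := ENNReal.rpow_le_rpow hm.le (z := ((m + 1 : ℕ) : ℝ)) (by positivity)
    rwa [← ENNReal.rpow_mul, one_div, inv_mul_cancel₀ (by positivity), ENNReal.rpow_one,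
      ENNReal.rpow_natCast] at h2
  rw [← ENNReal.coe_pow, ENNReal.coe_le_coe, ← NNReal.coe_le_coe] at h1
  simpa [Real.coe_toNNReal _ hρ.le] using h1

open scoped Pointwise in
/-- An equivalent seminorm in which the explicit Euler step of the linear flow generated by `B`
grows at most at a rate exceeding the spectral abscissa. -/
lemma exists_seminorm_euler_step_le {Na No : ℕ} (B : Matrix (Fin Na) (Fin Na) ℝ) {c ω : ℝ}
    (hcω : c < ω) (hB : ∀ ξ ∈ eigenvalues B, ξ.re ≤ c) :
    ∃ (N : Seminorm ℝ (State Na No)) (h a C : ℝ), 0 < h ∧ 0 < a ∧ 0 < C ∧ (∀ Z, a * ‖Z‖ ≤ N Z) ∧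
      (∀ Z, N Z ≤ C * ‖Z‖) ∧ ∀ Z, N (Z + h • act B Z) ≤ (1 + h * ω) * N Z := by
  obtain ⟨R, hR0, hR⟩ : ∃ R, 0 < R ∧ ∀ ξ ∈ eigenvalues B, ‖ξ‖ ≤ R := by
    obtain ⟨R, hR⟩ := (spectrum.isBounded (𝕜 := ℂ) (B.map (algebraMap ℝ ℂ))).exists_norm_le
    exact ⟨max R 1, by positivity, fun ξ hξ => (hR ξ hξ).trans (le_max_left _ _)⟩
  -- The first bound controls the quadratic term `h ^ 2 * ‖ζ‖ ^ 2` of `‖1 + h ζ‖ ^ 2`; the second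
  -- keeps `1 + h ω` positive when `ω` is negative.
  set h := min ((ω - c) / R ^ 2) (1 / (2 * (|ω| + 1))) with hh
  have hh0 : 0 < h := lt_min (div_pos (by linarith) (by positivity)) (by positivity)
  have hh1 : h * R ^ 2 ≤ ω - c := by
    have := min_le_left ((ω - c) / R ^ 2) (1 / (2 * (|ω| + 1)))
    rwa [← hh, le_div_iff₀ (by positivity)] at this
  have hρ : 0 < 1 + h * ω := by
    have := min_le_right ((ω - c) / R ^ 2) (1 / (2 * (|ω| + 1)))
    rw [← hh, le_div_iff₀ (by positivity)] at this
    nlinarith [neg_abs_le ω]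
  have hM : ∀ ξ ∈ eigenvalues (1 + h • B), ‖ξ‖ < 1 + h * ω := by
    intro ξ hξ
    have h1 : (1 + h • B).map (algebraMap ℝ ℂ) =
        algebraMap ℂ _ 1 + (h : ℂ) • B.map (algebraMap ℝ ℂ) := by
      ext i j
      by_cases hij : i = j <;> simp [hij]
    obtain ⟨ζ, hζ, rfl⟩ : ∃ ζ ∈ eigenvalues B, 1 + (h : ℂ) * ζ = ξ := by
      have hne : (h : ℂ) ≠ 0 := by exact_mod_cast hh0.ne'
      rw [eigenvalues, h1, ← spectrum.singleton_add_eq] at hξ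
      obtain ⟨x, hx, y, hy, rfl⟩ := Set.mem_add.1 hξ
      have h2 := spectrum.unit_smul_eq_smul (B.map (algebraMap ℝ ℂ)) (Units.mk0 (h : ℂ) hne)
      have h3 : y ∈ (Units.mk0 (h : ℂ) hne) • spectrum ℂ (B.map (algebraMap ℝ ℂ)) := by
        rw [← h2]; exact hy
      obtain ⟨ζ, hζ, rfl⟩ := h3
      exact ⟨ζ, hζ, by rw [Set.mem_singleton_iff.1 hx]; rfl⟩
    have h2 := hB ζ hζ
    have h3 : ζ.re ^ 2 + ζ.im ^ 2 ≤ R ^ 2 := by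
      have := hR ζ hζ
      have h4 : ‖ζ‖ ^ 2 ≤ R ^ 2 := by gcongr
      rwa [Complex.sq_norm, Complex.normSq_apply, ← sq, ← sq] at h4
    have h5 : ‖1 + (h : ℂ) * ζ‖ ^ 2 = 1 + 2 * h * ζ.re + h ^ 2 * (ζ.re ^ 2 + ζ.im ^ 2) := by
      rw [Complex.sq_norm, Complex.normSq_apply]
      simp
      ring
    -- The chain is `‖1 + h ζ‖ ^ 2 ≤ 1 + 2 h c + h (ω - c) < 1 + 2 h ω ≤ (1 + h ω) ^ 2`.
    refine lt_of_pow_lt_pow_left₀ 2 hρ.le ?_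
    rw [h5]
    have h6 : h ^ 2 * (ζ.re ^ 2 + ζ.im ^ 2) ≤ h * (ω - c) := by
      calc _ ≤ h ^ 2 * R ^ 2 := by gcongr
        _ = h * (h * R ^ 2) := by ring
        _ ≤ _ := by gcongr
    have h7 : h * ζ.re ≤ h * c := by gcongr
    have h8 : h * c < h * ω := by gcongr
    nlinarith [sq_nonneg (h * ω)]
  obtain ⟨m, hm⟩ := exists_norm_pow_le_of_eigenvalues _ hρ hM
  obtain ⟨N, a, C, ha, hC, h1, h2, h3⟩ := exists_seminorm_act_le (No := No) _ hρ m hm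
  refine ⟨N, h, a, C, hh0, ha, hC, h1, h2, fun Z => ?_⟩
  have := h3 Z
  rwa [act_add, act_one, act_smul] at this

end LinftyNorm

/-! ### Eigenvectors, Perron–Frobenius theory and simple eigenvalues -/

lemma exists_eigenvector_of_mem_eigenvalues {n : ℕ} {A : Matrix (Fin n) (Fin n) ℝ} {ξ : ℂ}
    (hξ : ξ ∈ eigenvalues A) :
    ∃ z : Fin n → ℂ, z ≠ 0 ∧ A.map (algebraMap ℝ ℂ) *ᵥ z = ξ • z := by
  rw [eigenvalues, ← Matrix.spectrum_toLin', ← Module.End.hasEigenvalue_iff_mem_spectrum] at hξ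
  obtain ⟨z, hz⟩ := hξ.exists_hasEigenvector
  exact ⟨z, hz.2, by simpa using hz.apply_eq_smul⟩

lemma mem_eigenvalues_of_eigenvector {n : ℕ} {A : Matrix (Fin n) (Fin n) ℝ} {ξ : ℂ}
    {z : Fin n → ℂ} (hz : z ≠ 0) (h : A.map (algebraMap ℝ ℂ) *ᵥ z = ξ • z) :
    ξ ∈ eigenvalues A := by
  rw [eigenvalues, ← Matrix.spectrum_toLin', ← Module.End.hasEigenvalue_iff_mem_spectrum]
  exact Module.End.hasEigenvalue_of_hasEigenvector (x := z)
    ⟨Module.End.mem_eigenspace_iff.2 (by simpa using h), hz⟩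

lemma ofReal_mem_eigenvalues {n : ℕ} {A : Matrix (Fin n) (Fin n) ℝ} {r : ℝ} {v : Fin n → ℝ}
    (hv : v ≠ 0) (h : A *ᵥ v = r • v) : (r : ℂ) ∈ eigenvalues A := by
  refine mem_eigenvalues_of_eigenvector (z := fun i => (v i : ℂ)) (fun h0 => hv ?_) ?_
  · ext i
    have : (v i : ℂ) = 0 := congrFun h0 i
    exact_mod_cast this
  · ext i
    have := congrArg (fun x : ℝ => (x : ℂ)) (congrFun h i)
    simpa [Matrix.mulVec, dotProduct] using this

/-- A nonnegative vector `y` with `A y ≤ μ y` vanishes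
identically as soon as one entry vanishes. -/
lemma pos_of_mulVec_le {n : ℕ} {A : Matrix (Fin n) (Fin n) ℝ} (hA : ∀ i k, 0 ≤ A i k)
    (hconn : StronglyConnected A) {y : Fin n → ℝ} (hy : ∀ i, 0 ≤ y i) (hy0 : y ≠ 0) {μ : ℝ}
    (h : ∀ i, (A *ᵥ y) i ≤ μ * y i) (i : Fin n) : 0 < y i := by
  refine lt_of_le_of_ne (hy i) fun hi => hy0 ?_
  ext k
  -- Zeros propagate along edges: if `y a = 0`, the nonnegative sum `∑ l, A a l * y l` is at most
  -- `0`, so `y b = 0` whenever `A a b ≠ 0`.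
  induction hconn i k with
  | refl => exact hi.symm
  | @tail a b _ hab ih =>
    have ha : ∑ l, A a l * y l ≤ 0 := by
      have := h a
      rw [ih] at this
      simpa [Matrix.mulVec, dotProduct] using this
    have h1 : A a b * y b ≤ ∑ l, A a l * y l :=
      Finset.single_le_sum (f := fun l => A a l * y l)
        (fun l _ => mul_nonneg (hA a l) (hy l)) (Finset.mem_univ b)
    have h2 : A a b * y b = 0 :=
      le_antisymm (h1.trans ha) (mul_nonneg (hA a b) (hy b))
    exact (mul_eq_zero.1 h2).resolve_left hab

lemma pow_nonneg_entry {n : ℕ} {A : Matrix (Fin n) (Fin n) ℝ} (hA : ∀ i k, 0 ≤ A i k) (m : ℕ) :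
    ∀ i k, 0 ≤ (A ^ m) i k := by
  induction m with
  | zero =>
    intro i k
    rw [pow_zero, Matrix.one_apply]
    split_ifs <;> norm_num
  | succ m ih =>
    intro i k
    rw [pow_succ, Matrix.mul_apply]
    exact Finset.sum_nonneg fun l _ => mul_nonneg (ih i l) (hA l k)

lemma exists_pow_pos {n : ℕ} {A : Matrix (Fin n) (Fin n) ℝ} (hA : ∀ i k, 0 ≤ A i k)
    (hconn : StronglyConnected A) (i k : Fin n) : ∃ m, 0 < (A ^ m) i k := by
  induction hconn i k with
  | refl => exact ⟨0, by simp⟩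
  | @tail a b _ hab ih =>
    obtain ⟨m, hm⟩ := ih
    refine ⟨m + 1, ?_⟩
    rw [pow_succ, Matrix.mul_apply]
    exact Finset.sum_pos' (fun l _ => mul_nonneg (pow_nonneg_entry hA m i l) (hA l b))
      ⟨a, Finset.mem_univ a, mul_pos hm (lt_of_le_of_ne (hA a b) hab.symm)⟩

/-- A strongly connected nonnegative matrix commutes with an entrywise positive matrix. -/
lemma exists_pos_commute {n : ℕ} {A : Matrix (Fin n) (Fin n) ℝ} (hA : ∀ i k, 0 ≤ A i k)
    (hconn : StronglyConnected A) :
    ∃ P : Matrix (Fin n) (Fin n) ℝ, (∀ i k, 0 < P i k) ∧ A * P = P * A := by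
  choose m hm using exists_pow_pos hA hconn
  refine ⟨∑ i, ∑ k, A ^ m i k, fun i k => ?_, ?_⟩
  · rw [Matrix.sum_apply]
    refine Finset.sum_pos' (fun a _ => ?_) ⟨i, Finset.mem_univ i, ?_⟩
    · rw [Matrix.sum_apply]
      exact Finset.sum_nonneg fun b _ => pow_nonneg_entry hA _ i k
    · rw [Matrix.sum_apply]
      exact Finset.sum_pos' (fun b _ => pow_nonneg_entry hA _ i k) ⟨k, Finset.mem_univ k, hm i k⟩
  · rw [Finset.mul_sum, Finset.sum_mul]
    refine Finset.sum_congr rfl fun i _ => ?_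
    rw [Finset.mul_sum, Finset.sum_mul]
    exact Finset.sum_congr rfl fun k _ => (Commute.refl A).pow_right _

/-- **Perron–Frobenius**: a strongly connected nonnegative matrix has a positive eigenvector. -/
lemma exists_pos_eigenvector {n : ℕ} [Nonempty (Fin n)] {A : Matrix (Fin n) (Fin n) ℝ}
    (hA : ∀ i k, 0 ≤ A i k) (hconn : StronglyConnected A) :
    ∃ (r : ℝ) (v : Fin n → ℝ), (∀ i, 0 < v i) ∧ A *ᵥ v = r • v := by
  let M : ℝ := ∑ i, ∑ k, A i k
  have hM0 : 0 ≤ M := Finset.sum_nonneg fun i _ => Finset.sum_nonneg fun k _ => hA i k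
  -- The eigenvalue is found by minimizing `μ` over pairs `(μ, x)` with `x` in the simplex and `A x
  -- ≤ μ x`. The bound `M` makes this set compact, and the uniform vector shows that it is nonempty.
  let K : Set (ℝ × (Fin n → ℝ)) :=
    (Set.Icc 0 M ×ˢ stdSimplex ℝ (Fin n)) ∩ {q | ∀ i, (A *ᵥ q.2) i ≤ q.1 * q.2 i}
  have hcont : ∀ i, Continuous fun q : ℝ × (Fin n → ℝ) => (A *ᵥ q.2) i := fun i =>
    (continuous_apply i).comp ((Continuous.matrix_mulVec continuous_const continuous_snd))
  have hK : IsCompact K := by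
    refine (isCompact_Icc.prod (isCompact_stdSimplex ℝ (Fin n))).inter_right ?_
    simp only [Set.ofPred_forall]
    exact isClosed_iInter fun i => isClosed_le (hcont i) (by fun_prop)
  have hn : (0 : ℝ) < n := by
    have := Fin.pos_iff_nonempty.2 ‹_›
    exact_mod_cast this
  have hKne : K.Nonempty := by
    refine ⟨(M, fun _ => (n : ℝ)⁻¹), ⟨⟨hM0, le_rfl⟩, fun i => by positivity, ?_⟩, fun i => ?_⟩
    · simp [hn.ne']
    · simp only [Matrix.mulVec, dotProduct, ← Finset.sum_mul]
      gcongr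
      exact Finset.single_le_sum (f := fun i => ∑ k, A i k)
        (fun i _ => Finset.sum_nonneg fun k _ => hA i k) (Finset.mem_univ i)
  obtain ⟨⟨r, x⟩, ⟨⟨hrM, hx⟩, hrx⟩, hmin⟩ := hK.exists_isMinOn hKne continuous_fst.continuousOn
  simp only [Set.mem_ofPred_eq] at hrM hx hrx
  have hx0 : x ≠ 0 := by
    rintro rfl
    have := hx.2
    simp at this
  have hxpos := pos_of_mulVec_le hA hconn hx.1 hx0 hrx
  refine ⟨r, x, hxpos, ?_⟩
  by_contra hne
  -- If `A x ≤ r x` were not an equality, applying a positive matrix commuting with `A` would make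
  -- the inequality strict in every entry, leaving room to lower `r`.
  obtain ⟨P, hP, hPA⟩ := exists_pos_commute hA hconn
  have hPpos : ∀ y : Fin n → ℝ, (∀ i, 0 ≤ y i) → y ≠ 0 → ∀ i, 0 < (P *ᵥ y) i := by
    intro y hy hy0 i
    obtain ⟨k, hk⟩ := Function.ne_iff.1 hy0
    exact Finset.sum_pos' (fun l _ => mul_nonneg (hP i l).le (hy l))
      ⟨k, Finset.mem_univ k, mul_pos (hP i k) (lt_of_le_of_ne (hy k) (Ne.symm hk))⟩
  set y := P *ᵥ x with hydef
  have hypos : ∀ i, 0 < y i := hPpos x hx.1 hx0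
  have hlt : ∀ i, (A *ᵥ y) i < r * y i := by
    intro i
    have h1 := hPpos (r • x - A *ᵥ x) (fun i => by simpa using hrx i)
      (fun h => hne (sub_eq_zero.1 h).symm) i
    rw [Matrix.mulVec_sub, Matrix.mulVec_smul, Matrix.mulVec_mulVec, ← hPA,
      ← Matrix.mulVec_mulVec] at h1
    simpa [hydef] using h1
  obtain ⟨i₀, -, hi₀⟩ := Finset.exists_max_image Finset.univ (fun i => (A *ᵥ y) i / y i)
    Finset.univ_nonempty
  set s := (A *ᵥ y) i₀ / y i₀ with hs
  have hsr : s < r := by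
    rw [hs, div_lt_iff₀ (hypos i₀)]
    exact hlt i₀
  have hAy : 0 ≤ ∑ k, A i₀ k * y k :=
    Finset.sum_nonneg fun k _ => mul_nonneg (hA _ _) (hypos k).le
  have hs0 : 0 ≤ s := div_nonneg hAy (hypos i₀).le
  have hsum : 0 < ∑ i, y i := Finset.sum_pos (fun i _ => hypos i) Finset.univ_nonempty
  have hmem : (s, (∑ i, y i)⁻¹ • y) ∈ K := by
    refine ⟨⟨⟨hs0, hsr.le.trans hrM.2⟩, fun i => ?_, ?_⟩, fun i => ?_⟩
    · exact mul_nonneg (inv_nonneg.2 hsum.le) (hypos i).le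
    · simp only [Pi.smul_apply, smul_eq_mul, ← Finset.mul_sum]
      exact inv_mul_cancel₀ hsum.ne'
    · simp only [Matrix.mulVec_smul, Pi.smul_apply, smul_eq_mul]
      have := hi₀ i (Finset.mem_univ i)
      rw [div_le_iff₀ (hypos i)] at this
      calc _ ≤ (∑ i, y i)⁻¹ * (s * y i) := by gcongr
        _ = _ := by ring
  exact absurd (hmin hmem) (not_le.2 hsr)

/-- In the sup norm weighted by `1 / v`, the nonnegative matrix `A` has operator norm at most `r`.
This is read off at an entry of the complex eigenvector where `‖z i‖ / v i` is largest. -/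
lemma norm_le_of_mem_eigenvalues {n : ℕ} {A : Matrix (Fin n) (Fin n) ℝ}
    (hA : ∀ i k, 0 ≤ A i k) {r : ℝ} {v : Fin n → ℝ} (hv : ∀ i, 0 < v i) (h : A *ᵥ v = r • v)
    {ξ : ℂ} (hξ : ξ ∈ eigenvalues A) : ‖ξ‖ ≤ r := by
  obtain ⟨z, hz, hzξ⟩ := exists_eigenvector_of_mem_eigenvalues hξ
  obtain ⟨k, hk⟩ := Function.ne_iff.1 hz
  obtain ⟨i, -, hi⟩ := Finset.exists_max_image Finset.univ (fun i => ‖z i‖ / v i)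
    ⟨k, Finset.mem_univ k⟩
  have hi' : ∀ l, ‖z l‖ ≤ ‖z i‖ / v i * v l := fun l =>
    (div_le_iff₀ (hv l)).1 (hi l (Finset.mem_univ l))
  have hzi : 0 < ‖z i‖ := by
    by_contra h0
    have h1 : ‖z i‖ = 0 := le_antisymm (not_lt.1 h0) (norm_nonneg _)
    have := hi' k
    rw [h1, zero_div, zero_mul] at this
    exact hk (norm_le_zero_iff.1 this)
  have h1 : ‖ξ‖ * ‖z i‖ ≤ r * ‖z i‖ := by
    calc ‖ξ‖ * ‖z i‖ = ‖∑ l, (A i l : ℂ) * z l‖ := by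
          rw [← norm_mul]
          exact congrArg norm (congrFun hzξ i).symm
      _ ≤ ∑ l, A i l * ‖z l‖ := by
          refine (norm_sum_le _ _).trans (Finset.sum_le_sum fun l _ => ?_)
          rw [norm_mul, Complex.norm_real, Real.norm_of_nonneg (hA i l)]
      _ ≤ ∑ l, A i l * (‖z i‖ / v i * v l) :=
          Finset.sum_le_sum fun l _ => mul_le_mul_of_nonneg_left (hi' l) (hA i l)
      _ = ‖z i‖ / v i * (A *ᵥ v) i := by
          simp only [Matrix.mulVec, dotProduct, Finset.mul_sum]
          exact Finset.sum_congr rfl fun l _ => by ring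
      _ = r * ‖z i‖ := by
          have := (hv i).ne'
          rw [h, Pi.smul_apply, smul_eq_mul]
          field_simp
  exact le_of_mul_le_mul_right h1 hzi

/-- The real eigenvalue of a positive eigenvector is the largest real part of an eigenvalue. -/
lemma isGreatest_realParts {n : ℕ} [Nonempty (Fin n)] {A : Matrix (Fin n) (Fin n) ℝ}
    (hA : ∀ i k, 0 ≤ A i k) {r : ℝ} {v : Fin n → ℝ} (hv : ∀ i, 0 < v i) (h : A *ᵥ v = r • v) :
    IsGreatest (realParts A) r := by
  constructor
  · refine ⟨r, ofReal_mem_eigenvalues (v := v) (fun h0 => ?_) h, Complex.ofReal_re r⟩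
    obtain ⟨i⟩ := ‹Nonempty (Fin n)›
    exact (hv i).ne' (congrFun h0 i)
  · rintro _ ⟨ξ, hξ, rfl⟩
    exact (Complex.re_le_norm ξ).trans (norm_le_of_mem_eigenvalues hA hv h hξ)

/-- The eigenspace of a positive eigenvector of a strongly connected matrix is a line. -/
lemma eq_smul_of_pos_eigenvector {n : ℕ} [Nonempty (Fin n)] {A : Matrix (Fin n) (Fin n) ℝ}
    (hA : ∀ i k, 0 ≤ A i k) (hconn : StronglyConnected A) {r : ℝ} {v : Fin n → ℝ}
    (hv : ∀ i, 0 < v i) (h : A *ᵥ v = r • v) {y : Fin n → ℝ} (hy : A *ᵥ y = r • y) :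
    ∃ t : ℝ, y = t • v := by
  -- The smallest ratio is the largest `t` with `y - t v ≥ 0`. This difference vanishes at `i`, so
  -- as a nonnegative eigenvector it must vanish altogether.
  obtain ⟨i, -, hi⟩ := Finset.exists_min_image Finset.univ (fun i => y i / v i)
    Finset.univ_nonempty
  refine ⟨y i / v i, ?_⟩
  by_contra hne
  have hw : A *ᵥ (y - (y i / v i) • v) = r • (y - (y i / v i) • v) := by
    rw [Matrix.mulVec_sub, Matrix.mulVec_smul, h, hy, smul_sub, smul_comm]
  have hpos := pos_of_mulVec_le hA hconn (y := y - (y i / v i) • v)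
    (fun k => by
      have := (le_div_iff₀ (hv k)).1 (hi k (Finset.mem_univ k))
      simpa using this)
    (sub_ne_zero.2 hne) (μ := r) (fun k => (congrFun hw k).le) i
  have := (hv i).ne'
  simp [this] at hpos

lemma StronglyConnected.transpose {n : ℕ} {A : Matrix (Fin n) (Fin n) ℝ}
    (hconn : StronglyConnected A) : StronglyConnected Aᵀ := by
  intro i k
  exact Relation.reflTransGen_swap.2 (hconn k i)

/-- **Perron–Frobenius**: right and left positive eigenvectors for the spectral abscissa. -/
lemma exists_perron_vectors {n : ℕ} {A : Matrix (Fin n) (Fin n) ℝ}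
    (hA : ∀ i k, 0 ≤ A i k) (hconn : StronglyConnected A) {lmax : ℝ}
    (hl : IsGreatest (realParts A) lmax) :
    ∃ v ℓ : Fin n → ℝ, (∀ i, 0 < v i) ∧ (∀ i, 0 < ℓ i) ∧ A *ᵥ v = lmax • v ∧
      ℓ ᵥ* A = lmax • ℓ ∧ ℓ ⬝ᵥ v = 1 ∧ ∀ y, A *ᵥ y = lmax • y → ∃ t : ℝ, y = t • v := by
  have hne : Nonempty (Fin n) := by
    obtain ⟨ξ, hξ, -⟩ := hl.1
    obtain ⟨z, hz, -⟩ := exists_eigenvector_of_mem_eigenvalues hξ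
    exact ⟨(Function.ne_iff.1 hz).choose⟩
  obtain ⟨r, v, hv, hrv⟩ := exists_pos_eigenvector hA hconn
  obtain rfl : r = lmax := (isGreatest_realParts hA hv hrv).unique hl
  obtain ⟨r', ℓ, hℓ, hrℓ⟩ := exists_pos_eigenvector (A := Aᵀ) (fun i k => hA k i) hconn.transpose
  have hdot : 0 < ℓ ⬝ᵥ v :=
    Finset.sum_pos (fun i _ => mul_pos (hℓ i) (hv i)) Finset.univ_nonempty
  rw [Matrix.mulVec_transpose] at hrℓ
  -- Evaluating `ℓ A v` from both sides identifies the eigenvalues, since `ℓ ⬝ᵥ v > 0`.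
  have hr : r' = r := by
    have h1 := Matrix.dotProduct_mulVec ℓ A v
    rw [hrv, hrℓ, dotProduct_smul, smul_dotProduct, smul_eq_mul, smul_eq_mul] at h1
    exact (mul_right_cancel₀ hdot.ne' h1).symm
  subst hr
  refine ⟨v, (ℓ ⬝ᵥ v)⁻¹ • ℓ, hv, fun i => mul_pos (inv_pos.2 hdot) (hℓ i), hrv, ?_, ?_,
    fun y hy => eq_smul_of_pos_eigenvector hA hconn hv hrv hy⟩
  · rw [Matrix.smul_vecMul, hrℓ, smul_comm]
  · rw [smul_dotProduct, smul_eq_mul, inv_mul_cancel₀ hdot.ne']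

/-- An algebraically simple eigenvalue has a one-dimensional eigenspace and a left eigenvector
that does not annihilate the right one. -/
lemma exists_left_eigenvector_of_simple {n : ℕ} {A : Matrix (Fin n) (Fin n) ℝ} {r : ℝ}
    {v : Fin n → ℝ} (hv : v ≠ 0) (h : A *ᵥ v = r • v)
    (hsimple : A.charpoly.rootMultiplicity r = 1) :
    ∃ ℓ : Fin n → ℝ, ℓ ᵥ* A = r • ℓ ∧ ℓ ⬝ᵥ v = 1 ∧
      ∀ y, A *ᵥ y = r • y → ∃ t : ℝ, y = t • v := by
  set f : Module.End ℝ (Fin n → ℝ) := Matrix.toLin' A with hf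
  have hfin : Module.finrank ℝ (f.maxGenEigenspace r) = 1 := by
    rw [LinearMap.finrank_maxGenEigenspace_eq, hf, Matrix.charpoly_toLin', hsimple]
  have hle : ∀ k : ℕ, f.genEigenspace r k ≤ f.maxGenEigenspace r := fun k =>
    f.genEigenspace_le_maximal r k
  have hmem : ∀ y, A *ᵥ y = r • y → y ∈ f.maxGenEigenspace r := fun y hy =>
    hle 1 (by
      rw [Module.End.mem_genEigenspace_nat, pow_one, LinearMap.mem_ker]
      simp [hf, hy])
  have hspan : ∀ y ∈ f.maxGenEigenspace r, ∃ t : ℝ, y = t • v := by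
    intro y hy
    obtain ⟨t, ht⟩ := (finrank_eq_one_iff_of_nonzero' (⟨v, hmem v h⟩ : f.maxGenEigenspace r)
      (fun h0 => hv (congrArg Subtype.val h0))).1 hfin ⟨y, hy⟩
    exact ⟨t, (congrArg Subtype.val ht).symm⟩
  set g := f - algebraMap ℝ _ r with hg
  have hgv : g v = 0 := by simp [hg, hf, h, Module.algebraMap_end_apply]
  -- A preimage `y` of `v` would be a generalized eigenvector of order two. The generalized
  -- eigenspace is the line `ℝ v`, so `g y = 0`, contradicting `v ≠ 0`.
  have hv' : v ∉ LinearMap.range g := by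
    rintro ⟨y, hy⟩
    have hy2 : y ∈ f.maxGenEigenspace r := by
      refine hle 2 ?_
      rw [Module.End.mem_genEigenspace_nat, LinearMap.mem_ker, pow_two, Module.End.mul_apply]
      change g (g y) = 0
      rw [hy, hgv]
    obtain ⟨t, rfl⟩ := hspan y hy2
    rw [map_smul, hgv, smul_zero] at hy
    exact hv hy.symm
  -- A functional that vanishes on the range of `A - r` is a left eigenvector for `r`; being nonzero
  -- at `v`, it can be normalized.
  obtain ⟨φ, hφ, hφg⟩ := Submodule.exists_dual_map_eq_bot_of_notMem hv' inferInstance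
  set ℓ : Fin n → ℝ := fun i => φ (Pi.single i 1) with hℓ
  have hφℓ : ∀ y, φ y = ℓ ⬝ᵥ y := by
    intro y
    conv_lhs => rw [pi_eq_sum_univ' y]
    simp [dotProduct, hℓ, mul_comm]
  have hℓA : ∀ y, ℓ ⬝ᵥ (A *ᵥ y) = r * (ℓ ⬝ᵥ y) := by
    intro y
    have h1 : φ (g y) = 0 := by
      have : φ (g y) ∈ (LinearMap.range g).map φ := Submodule.mem_map_of_mem ⟨y, rfl⟩
      rwa [hφg, Submodule.mem_bot] at this
    have h2 : g y = A *ᵥ y - r • y := by simp [hg, hf, Module.algebraMap_end_apply]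
    rw [h2, map_sub, map_smul, hφℓ, hφℓ, smul_eq_mul] at h1
    linarith
  rw [hφℓ] at hφ
  refine ⟨(ℓ ⬝ᵥ v)⁻¹ • ℓ, ?_, ?_, fun y hy => hspan y (hmem y hy)⟩
  · rw [Matrix.smul_vecMul, smul_comm]
    congr 1
    ext i
    have := hℓA (Pi.single i 1)
    rw [Matrix.dotProduct_mulVec] at this
    simpa using this
  · rw [smul_dotProduct, smul_eq_mul, inv_mul_cancel₀ hφ]

/-! ### The vector field: projection, linear part and quadratic remainder -/

/-- The projection `P0` applied to every agent's opinion vector. -/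
noncomputable def projState {Na No : ℕ} : State Na No →ₗ[ℝ] State Na No where
  toFun Z := fun i => P0 (Z i)
  map_add' Y Z := by
    ext i j
    simp only [P0, Pi.add_apply, Finset.sum_add_distrib]
    ring
  map_smul' c Z := by
    ext i j
    simp only [P0, Pi.smul_apply, smul_eq_mul, ← Finset.mul_sum, RingHom.id_apply]
    ring

lemma projState_apply {Na No : ℕ} (Z : State Na No) (i) : projState Z i = P0 (Z i) := rfl

lemma P0_mem {No : ℕ} (y : Fin No → ℝ) : P0 y ∈ optionSpace No := by
  change ∑ j, P0 y j = 0
  rcases Nat.eq_zero_or_pos No with rfl | hNo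
  · simp
  · have : (No : ℝ) ≠ 0 := by positivity
    simp only [P0, Finset.sum_sub_distrib, Finset.sum_const, Finset.card_univ, Fintype.card_fin,
      nsmul_eq_mul]
    field_simp
    ring

lemma P0_eq_self {No : ℕ} {y : Fin No → ℝ} (hy : y ∈ optionSpace No) : P0 y = y := by
  have hy' : ∑ j, y j = 0 := hy
  ext j
  simp [P0, hy']

lemma abs_P0_le {No : ℕ} {y : Fin No → ℝ} {r : ℝ} (hy : ∀ j, |y j| ≤ r) (j : Fin No) :
    |P0 y j| ≤ 2 * r := by
  have hNo : (0 : ℝ) < No := by exact_mod_cast (Fin.pos_iff_nonempty.2 ⟨j⟩)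
  have h1 : |∑ l, y l| ≤ No * r := by
    refine (Finset.abs_sum_le_sum_abs _ _).trans ((Finset.sum_le_sum fun l _ => hy l).trans ?_)
    simp
  have h2 : |1 / (No : ℝ) * ∑ l, y l| ≤ r := by
    rw [abs_mul, abs_of_pos (by positivity)]
    calc 1 / (No : ℝ) * |∑ l, y l| ≤ 1 / (No : ℝ) * (No * r) := by gcongr
      _ = r := by field_simp
  calc |P0 y j| ≤ |y j| + |1 / (No : ℝ) * ∑ l, y l| := abs_sub _ _
    _ ≤ r + r := add_le_add (hy j) h2
    _ = 2 * r := by ring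

lemma projState_mem {Na No : ℕ} (Z : State Na No) : projState Z ∈ stateSpace Na No :=
  fun i => P0_mem (Z i)

lemma projState_eq_self {Na No : ℕ} {Z : State Na No} (hZ : Z ∈ stateSpace Na No) :
    projState Z = Z := funext fun i => P0_eq_self (hZ i)

lemma abs_apply_le_norm {Na No : ℕ} (Z : State Na No) (i j) : |Z i j| ≤ ‖Z‖ :=
  (norm_le_pi_norm (Z i) j).trans (norm_le_pi_norm Z i)

lemma norm_le_of_abs_apply_le {Na No : ℕ} {Z : State Na No} {r : ℝ} (hr : 0 ≤ r)
    (h : ∀ i j, |Z i j| ≤ r) : ‖Z‖ ≤ r :=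
  (pi_norm_le_iff_of_nonneg hr).2 fun i => (pi_norm_le_iff_of_nonneg hr).2 fun j => h i j

lemma norm_projState_le {Na No : ℕ} (Z : State Na No) : ‖projState Z‖ ≤ 2 * ‖Z‖ :=
  norm_le_of_abs_apply_le (by positivity) fun i j => abs_P0_le (fun l => abs_apply_le_norm Z i l) j

lemma projState_act {Na No : ℕ} (M : Matrix (Fin Na) (Fin Na) ℝ) (Z : State Na No) :
    projState (act M Z) = act M (projState Z) := by
  ext i j
  simp only [projState_apply, P0, act_apply, mul_sub, Finset.sum_sub_distrib]
  congr 1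
  rw [Finset.sum_comm, Finset.mul_sum]
  refine Finset.sum_congr rfl fun k _ => ?_
  rw [← Finset.mul_sum]
  ring

lemma act_mem {Na No : ℕ} (M : Matrix (Fin Na) (Fin Na) ℝ) {Z : State Na No}
    (hZ : Z ∈ stateSpace Na No) : act M Z ∈ stateSpace Na No := by
  rw [← projState_eq_self hZ, ← projState_act]
  exact projState_mem _

lemma tensor_mem {Na No : ℕ} (v : Fin Na → ℝ) {w : Fin No → ℝ} (hw : w ∈ optionSpace No) :
    tensor v w ∈ stateSpace Na No := fun i => (optionSpace No).smul_mem (v i) hw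

/-- The opinion dynamics in terms of the matrices `P` and `Q` that combine the opinions about the
same option and about the other options. -/
noncomputable def field {Na No : ℕ} (S₁ S₂ : ℝ → ℝ) (P Q : Matrix (Fin Na) (Fin Na) ℝ) (d u : ℝ)
    (Z : State Na No) : State Na No :=
  projState fun i j => -d * Z i j + u * (S₁ (act P Z i j) - S₂ (act Q Z i j))

lemma act_smul_one_add {Na No : ℕ} {A : Matrix (Fin Na) (Fin Na) ℝ} (hA : ∀ i, A i i = 0)
    (a g : ℝ) (Z : State Na No) (i j) :
    act (a • 1 + g • A) Z i j =
      a * Z i j + ∑ k ∈ Finset.univ.erase i, (g • A) i k * Z k j := by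
  have h : ∑ k ∈ Finset.univ.erase i, (g • A) i k * Z k j = act (g • A) Z i j := by
    rw [act_apply, ← Finset.add_sum_erase _ _ (Finset.mem_univ i)]
    simp [hA]
  rw [h, act_add, act_smul, act_one]
  rfl

/-- Adding and subtracting the term `l = j` completes the inter-option sum. The full sum does not
depend on `j` and is removed by `P0`, leaving `S₂` with a minus sign. -/
lemma homField_eq_field {Na No : ℕ} (hNo : No ≠ 0) (S₁ S₂ : ℝ → ℝ)
    {A : Matrix (Fin Na) (Fin Na) ℝ} (hA : ∀ i, A i i = 0) (d α β γ δ : ℝ) :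
    homField (No := No) S₁ S₂ A d α β γ δ = field S₁ S₂ (α • 1 + γ • A) (β • 1 + δ • A) d := by
  ext u Z i j
  have hNo' : (No : ℝ) ≠ 0 := by exact_mod_cast hNo
  have hd : ∀ j, drive S₁ S₂ (homogeneous Na No A d α β γ δ u) Z i j =
      (-d * Z i j + u * (S₁ (act (α • 1 + γ • A) Z i j) - S₂ (act (β • 1 + δ • A) Z i j))) +
        u * ∑ l, S₂ (act (β • 1 + δ • A) Z i l) := by
    intro j
    simp only [drive, homogeneous, act_smul_one_add hA]
    rw [← Finset.add_sum_erase _ _ (Finset.mem_univ j)]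
    ring
  simp only [homField, vectorField, field, projState_apply, P0, hd]
  rw [Finset.sum_add_distrib]
  simp only [Finset.sum_const, Finset.card_univ, Fintype.card_fin, nsmul_eq_mul]
  field_simp
  ring

/-- Second-order Taylor expansion of a saturating function with Peano remainder. -/
lemma IsSaturating.taylor {S : ℝ → ℝ} (hS : IsSaturating S) {η : ℝ} (hη : 0 < η) :
    ∃ r > 0, ∀ x, |x| ≤ r → |S x - x - iteratedDeriv 2 S 0 / 2 * x ^ 2| ≤ η * x ^ 2 := by
  set b := iteratedDeriv 2 S 0 with hb
  have hdS : Differentiable ℝ S := hS.contDiff.differentiable (by norm_num)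
  have hdS' : DifferentiableAt ℝ (deriv S) 0 := by
    have := hS.contDiff.differentiable_iteratedDeriv 1 (by norm_num)
    rw [iteratedDeriv_one] at this
    exact this 0
  have hd : HasDerivAt (deriv S) b 0 := by
    have := hdS'.hasDerivAt
    rwa [hb, iteratedDeriv_succ, iteratedDeriv_one]
  have ho := (hasDerivAt_iff_isLittleO.1 hd).def hη
  obtain ⟨r, hr, hball⟩ := Metric.eventually_nhds_iff_ball.1 ho
  refine ⟨r / 2, by positivity, fun x hx => ?_⟩
  have hg : ∀ y, HasDerivAt (fun y => S y - y - b / 2 * y ^ 2) (deriv S y - 1 - b * y) y := by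
    intro y
    have := (((hdS y).hasDerivAt).sub (hasDerivAt_id y)).sub
      (((hasDerivAt_id y).pow 2).const_mul (b / 2))
    refine HasDerivAt.congr_deriv (f := fun y => S y - y - b / 2 * y ^ 2) this ?_
    simp
    ring
  -- The first-order expansion of `deriv S` at `0` bounds the derivative of the Taylor remainder by
  -- `η * |x|` on this ball; the mean value inequality supplies the second factor `|x|`.
  have hbd : ∀ y ∈ Metric.closedBall (0 : ℝ) |x|, ‖deriv S y - 1 - b * y‖ ≤ η * |x| := by
    intro y hy
    have hy' : |y| ≤ |x| := by simpa using hy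
    have h1 := hball y (by
      rw [Metric.mem_ball, dist_zero_right, Real.norm_eq_abs]
      linarith)
    rw [hS.deriv_zero, sub_zero, smul_eq_mul, mul_comm y b] at h1
    exact h1.trans (by rw [Real.norm_eq_abs]; gcongr)
  have := (convex_closedBall (0 : ℝ) |x|).norm_image_sub_le_of_norm_hasDerivWithin_le
    (fun y _ => (hg y).hasDerivWithinAt) hbd (x := 0) (y := x) (by simp) (by simp)
  simpa [hS.map_zero, mul_assoc, ← sq] using this

/-- The nonlinear part of the drive, up to the factor `u`. -/
def remainder {Na No : ℕ} (S₁ S₂ : ℝ → ℝ) (P Q : Matrix (Fin Na) (Fin Na) ℝ)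
    (Z : State Na No) : State Na No :=
  fun i j => (S₁ (act P Z i j) - act P Z i j) - (S₂ (act Q Z i j) - act Q Z i j)

lemma field_eq {Na No : ℕ} (S₁ S₂ : ℝ → ℝ) (P Q : Matrix (Fin Na) (Fin Na) ℝ) (d u : ℝ)
    (Z : State Na No) :
    field S₁ S₂ P Q d u Z =
      projState (act (-d • 1 + u • (P - Q)) Z) + u • projState (remainder S₁ S₂ P Q Z) := by
  rw [← map_smul, ← map_add, field]
  congr 1
  ext i j
  rw [act_add, act_smul, act_smul, act_one, act_sub]
  simp only [remainder, Pi.add_apply, Pi.smul_apply, Pi.sub_apply, smul_eq_mul]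
  ring

lemma field_eq_of_mem {Na No : ℕ} (S₁ S₂ : ℝ → ℝ) (P Q : Matrix (Fin Na) (Fin Na) ℝ) (d u : ℝ)
    {Z : State Na No} (hZ : Z ∈ stateSpace Na No) :
    field S₁ S₂ P Q d u Z =
      act (-d • 1 + u • (P - Q)) Z + u • projState (remainder S₁ S₂ P Q Z) := by
  rw [field_eq, projState_act, projState_eq_self hZ]

/-- Second-order expansion of the nonlinear part of the drive. -/
lemma remainder_taylor {Na No : ℕ} {S₁ S₂ : ℝ → ℝ} (hS₁ : IsSaturating S₁) (hS₂ : IsSaturating S₂)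
    (P Q : Matrix (Fin Na) (Fin Na) ℝ) {η : ℝ} (hη : 0 < η) :
    ∃ r > 0, ∀ Z : State Na No, ‖Z‖ ≤ r → ∀ i j,
      |remainder S₁ S₂ P Q Z i j - (iteratedDeriv 2 S₁ 0 / 2 * act P Z i j ^ 2 -
        iteratedDeriv 2 S₂ 0 / 2 * act Q Z i j ^ 2)| ≤ η * ‖Z‖ ^ 2 := by
  obtain ⟨C₁, hC₁, hP⟩ := exists_norm_act_le (No := No) P
  obtain ⟨C₂, hC₂, hQ⟩ := exists_norm_act_le (No := No) Q
  obtain ⟨r₁, hr₁, h₁⟩ := hS₁.taylor (η := η / (2 * C₁ ^ 2)) (by positivity)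
  obtain ⟨r₂, hr₂, h₂⟩ := hS₂.taylor (η := η / (2 * C₂ ^ 2)) (by positivity)
  refine ⟨min (r₁ / C₁) (r₂ / C₂), lt_min (by positivity) (by positivity), fun Z hZ i j => ?_⟩
  have hZ₁ : C₁ * ‖Z‖ ≤ r₁ := by
    have := hZ.trans (min_le_left _ _)
    rwa [le_div_iff₀ hC₁, mul_comm] at this
  have hZ₂ : C₂ * ‖Z‖ ≤ r₂ := by
    have := hZ.trans (min_le_right _ _)
    rwa [le_div_iff₀ hC₂, mul_comm] at this
  have hp := (abs_apply_le_norm (act P Z) i j).trans (hP Z)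
  have hq := (abs_apply_le_norm (act Q Z) i j).trans (hQ Z)
  have e₁ := h₁ _ (hp.trans hZ₁)
  have e₂ := h₂ _ (hq.trans hZ₂)
  have hp2 : act P Z i j ^ 2 ≤ (C₁ * ‖Z‖) ^ 2 := sq_le_sq' (neg_le_of_abs_le hp) (le_of_abs_le hp)
  have hq2 : act Q Z i j ^ 2 ≤ (C₂ * ‖Z‖) ^ 2 := sq_le_sq' (neg_le_of_abs_le hq) (le_of_abs_le hq)
  have f₁ : η / (2 * C₁ ^ 2) * act P Z i j ^ 2 ≤ η / 2 * ‖Z‖ ^ 2 := by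
    calc _ ≤ η / (2 * C₁ ^ 2) * (C₁ * ‖Z‖) ^ 2 := by gcongr
      _ = _ := by field_simp
  have f₂ : η / (2 * C₂ ^ 2) * act Q Z i j ^ 2 ≤ η / 2 * ‖Z‖ ^ 2 := by
    calc _ ≤ η / (2 * C₂ ^ 2) * (C₂ * ‖Z‖) ^ 2 := by gcongr
      _ = _ := by field_simp
  rw [abs_le] at e₁ e₂ ⊢
  simp only [remainder]
  constructor <;> linarith

lemma exists_norm_remainder_le {Na No : ℕ} {S₁ S₂ : ℝ → ℝ} (hS₁ : IsSaturating S₁)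
    (hS₂ : IsSaturating S₂) (P Q : Matrix (Fin Na) (Fin Na) ℝ) :
    ∃ K r : ℝ, 0 < K ∧ 0 < r ∧ ∀ Z : State Na No, ‖Z‖ ≤ r →
      ‖projState (remainder S₁ S₂ P Q Z)‖ ≤ K * ‖Z‖ ^ 2 := by
  obtain ⟨C₁, hC₁, hP⟩ := exists_norm_act_le (No := No) P
  obtain ⟨C₂, hC₂, hQ⟩ := exists_norm_act_le (No := No) Q
  obtain ⟨r, hr, h⟩ := remainder_taylor (No := No) hS₁ hS₂ P Q one_pos
  set b₁ := iteratedDeriv 2 S₁ 0 / 2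
  set b₂ := iteratedDeriv 2 S₂ 0 / 2
  refine ⟨2 * (1 + |b₁| * C₁ ^ 2 + |b₂| * C₂ ^ 2), r, by positivity, hr, fun Z hZ => ?_⟩
  refine (norm_projState_le _).trans ?_
  rw [mul_assoc]
  refine mul_le_mul_of_nonneg_left ?_ zero_le_two
  refine norm_le_of_abs_apply_le (by positivity) fun i j => ?_
  have hp := (abs_apply_le_norm (act P Z) i j).trans (hP Z)
  have hq := (abs_apply_le_norm (act Q Z) i j).trans (hQ Z)
  have f₁ : |b₁ * act P Z i j ^ 2| ≤ |b₁| * (C₁ * ‖Z‖) ^ 2 := by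
    rw [abs_mul, abs_pow]
    gcongr
  have f₂ : |b₂ * act Q Z i j ^ 2| ≤ |b₂| * (C₂ * ‖Z‖) ^ 2 := by
    rw [abs_mul, abs_pow]
    gcongr
  have e := h Z hZ i j
  rw [abs_le] at e f₁ f₂ ⊢
  constructor <;> nlinarith

/-- The Jacobian of the opinion dynamics at the neutral point. -/
lemma hasFDerivAt_field {Na No : ℕ} {S₁ S₂ : ℝ → ℝ} (hS₁ : IsSaturating S₁)
    (hS₂ : IsSaturating S₂) (P Q : Matrix (Fin Na) (Fin Na) ℝ) (d u : ℝ) :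
    HasFDerivAt (field (No := No) S₁ S₂ P Q d u)
      (LinearMap.toContinuousLinearMap (projState.comp (act (-d • 1 + u • (P - Q))))) 0 := by
  obtain ⟨K, r, hK, hr, h⟩ := exists_norm_remainder_le (No := No) hS₁ hS₂ P Q
  have h0 : remainder (No := No) S₁ S₂ P Q 0 = 0 := by
    ext i j
    simp [remainder, hS₁.map_zero, hS₂.map_zero]
  rw [hasFDerivAt_iff_isLittleO_nhds_zero]
  have hO : (fun Z : State Na No => u • projState (remainder S₁ S₂ P Q Z)) =O[𝓝 0]
      fun Z => ‖Z‖ ^ 2 := by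
    refine Asymptotics.IsBigO.of_bound (|u| * K) ?_
    filter_upwards [Metric.closedBall_mem_nhds (0 : State Na No) hr] with Z hZ
    rw [norm_smul, Real.norm_eq_abs, norm_pow, norm_norm, mul_assoc]
    exact mul_le_mul_of_nonneg_left (h Z (by simpa using hZ)) (abs_nonneg u)
  have ho : (fun Z : State Na No => ‖Z‖ ^ 2) =o[𝓝 0] fun Z => Z := by
    simpa using Asymptotics.isLittleO_norm_pow_id (E' := State Na No) one_lt_two
  refine (hO.trans_isLittleO ho).congr_left fun Z => ?_
  simp [field_eq, h0]

/-! ### Linearized stability and instability -/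

/-- A shorter Euler step is a convex combination of no step and the full step. Hence a bound for the
single step size `h` yields the infinitesimal growth rate `ω`. -/
lemma _root_.Seminorm.le_add_of_convex_step {E : Type*} [AddCommGroup E] [Module ℝ E]
    (N : Seminorm ℝ E) (L : E →ₗ[ℝ] E) {h ω : ℝ} (hh : 0 < h) {x : E}
    (hN : N (x + h • L x) ≤ (1 + h * ω) * N x) {τ : ℝ} (hτ : 0 ≤ τ) (hτh : τ ≤ h) :
    N (x + τ • L x) ≤ (1 + τ * ω) * N x := by
  have h1 : x + τ • L x = (1 - τ / h) • x + (τ / h) • (x + h • L x) := by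
    rw [smul_add, smul_smul, div_mul_cancel₀ _ hh.ne']
    module
  have h2 : 0 ≤ 1 - τ / h := by rw [sub_nonneg, div_le_one hh]; exact hτh
  have h3 : 0 ≤ τ / h := by positivity
  calc N (x + τ • L x) ≤ (1 - τ / h) * N x + τ / h * N (x + h • L x) := by
        rw [h1]
        refine (map_add_le_add N _ _).trans ?_
        rw [map_smul_eq_mul, map_smul_eq_mul, Real.norm_of_nonneg h2, Real.norm_of_nonneg h3]
    _ ≤ (1 - τ / h) * N x + τ / h * ((1 + h * ω) * N x) := by gcongr
    _ = _ := by field_simp; ring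

/-- The growth of an adapted seminorm along a curve with velocity `L x + y`. -/
lemma _root_.Seminorm.eventually_slope_lt {E : Type*} [NormedAddCommGroup E] [NormedSpace ℝ E]
    (N : Seminorm ℝ E) (L : E →ₗ[ℝ] E) {h ω C : ℝ} (hh : 0 < h) (hC : 0 < C)
    (hNC : ∀ x, N x ≤ C * ‖x‖) (hN : ∀ x, N (x + h • L x) ≤ (1 + h * ω) * N x)
    {X : ℝ → E} {t : ℝ} {y : E} (hX : HasDerivWithinAt X (L (X t) + y) (Set.Ici t) t) {r : ℝ}
    (hr : ω * N (X t) + N y < r) : ∀ᶠ z in 𝓝[>] t, slope (fun s => N (X s)) t z < r := by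
  set ε := (r - (ω * N (X t) + N y)) / (2 * C) with hε
  have hε0 : 0 < ε := div_pos (by linarith) (by positivity)
  have ho := (hasDerivWithinAt_iff_isLittleO.1 hX).def hε0
  have ho' := ho.filter_mono (nhdsWithin_mono t Set.Ioi_subset_Ici_self)
  have hnear : ∀ᶠ z in 𝓝[>] t, z < t + h :=
    nhdsWithin_le_nhds (gt_mem_nhds (by linarith))
  filter_upwards [ho', hnear, self_mem_nhdsWithin] with z hz hzh hzt
  have hτ : 0 < z - t := sub_pos.2 hzt
  rw [Real.norm_of_nonneg hτ.le] at hz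
  have h1 : X z = (X t + (z - t) • L (X t)) + (z - t) • y +
      (X z - X t - (z - t) • (L (X t) + y)) := by module
  have h2 : N (X z) ≤ (1 + (z - t) * ω) * N (X t) + (z - t) * N y + C * (ε * (z - t)) := by
    rw [h1]
    refine (map_add_le_add N _ _).trans (add_le_add ((map_add_le_add N _ _).trans
      (add_le_add ?_ ?_)) ?_)
    · exact N.le_add_of_convex_step L hh (hN _) hτ.le (by linarith)
    · rw [map_smul_eq_mul, Real.norm_of_nonneg hτ.le]
    · exact (hNC _).trans (mul_le_mul_of_nonneg_left hz hC.le)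
  have h3 : C * ε = (r - (ω * N (X t) + N y)) / 2 := by
    rw [hε]
    field_simp
  rw [slope_def_field, div_lt_iff₀ hτ]
  have h4 : C * (ε * (z - t)) = (r - (ω * N (X t) + N y)) / 2 * (z - t) := by rw [← h3]; ring
  rw [h4] at h2
  nlinarith

lemma _root_.Seminorm.continuous_of_le_mul_norm {E : Type*} [NormedAddCommGroup E]
    [NormedSpace ℝ E] (N : Seminorm ℝ E) {C : ℝ} (hNC : ∀ x, N x ≤ C * ‖x‖) : Continuous N := by
  refine Seminorm.continuous_of_continuousAt_zero ?_
  rw [ContinuousAt, map_zero]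
  refine squeeze_zero (fun x => apply_nonneg N x) hNC ?_
  have : Filter.Tendsto (fun x : E => C * ‖x‖) (𝓝 0) (𝓝 (C * ‖(0 : E)‖)) :=
    (continuous_const.mul continuous_norm).tendsto 0
  simpa using this

lemma hasDerivWithinAt_Ici_of_Icc {E : Type*} [NormedAddCommGroup E] [NormedSpace ℝ E]
    {X : ℝ → E} {X' : E} {T t : ℝ} (ht : t ∈ Set.Ico 0 T)
    (h : HasDerivWithinAt X X' (Set.Icc 0 T) t) : HasDerivWithinAt X X' (Set.Ici t) t :=
  (h.mono (Set.Icc_subset_Icc_left ht.1)).mono_of_mem_nhdsWithin (Icc_mem_nhdsGE ht.2)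

/-- Linearized stability: if an adapted seminorm decays along the linear flow, the neutral point
is locally exponentially stable. -/
lemma locallyExpStable_of_linearization {Na No : ℕ} {f : State Na No → State Na No}
    (L : State Na No →ₗ[ℝ] State Na No) (N : Seminorm ℝ (State Na No)) {h a C ω K r : ℝ}
    (hh : 0 < h) (ha : 0 < a) (hC : 0 < C) (hNa : ∀ Z, a * ‖Z‖ ≤ N Z)
    (hNC : ∀ Z, N Z ≤ C * ‖Z‖) (hN : ∀ Z, N (Z + h • L Z) ≤ (1 + h * ω) * N Z) (hω : ω < 0)
    (hK : 0 < K) (hr : 0 < r)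
    (hf : ∀ Z ∈ stateSpace Na No, ‖Z‖ ≤ r → ‖f Z - L Z‖ ≤ K * ‖Z‖ ^ 2) : LocallyExpStable f := by
  -- While `N` stays below `b`, the first bound keeps the state in the ball of radius `r`, and the
  -- second makes the nonlinear contribution at most `-ω / 4` times the barrier.
  set b := min (a * r) (-ω * a ^ 2 / (4 * C * K)) with hb
  have hb0 : 0 < b := lt_min (by positivity) (div_pos (mul_pos (by linarith) (by positivity))
    (by positivity))
  refine ⟨b / C, C / a, -ω / 2, by positivity, by positivity, by linarith,
    fun T Z hT hZ hZ0 => ?_⟩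
  have key : ∀ n₀, 0 < n₀ → N (Z 0) ≤ n₀ → n₀ ≤ b → ∀ t ∈ Set.Icc 0 T,
      N (Z t) ≤ n₀ * Real.exp (-(-ω / 2) * t) := by
    intro n₀ hn₀ hZn hnb
    -- Where `N` meets the barrier `β`, its growth rate is at most `ω β - (ω / 4) β`, strictly less
    -- than the barrier's rate `(ω / 2) β`.
    refine image_le_of_liminf_slope_right_lt_deriv_boundary
      (f := fun t => N (Z t)) (f' := fun t => ω * N (Z t) + N (f (Z t) - L (Z t)))
      (B' := fun t => n₀ * (Real.exp (-(-ω / 2) * t) * (-(-ω / 2))))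
      ((N.continuous_of_le_mul_norm hNC).comp_continuousOn fun t ht =>
        (hZ t ht).2.continuousWithinAt) ?_ ?_ ?_ ?_
    · intro t ht s hs
      refine (N.eventually_slope_lt L hh hC hNC hN (y := f (Z t) - L (Z t)) ?_ hs).frequently
      rw [add_sub_cancel]
      exact hasDerivWithinAt_Ici_of_Icc ht (hZ t (Set.Ico_subset_Icc_self ht)).2
    · simpa using hZn
    · intro t
      have : HasDerivAt (fun t : ℝ => -(-ω / 2) * t) (-(-ω / 2)) t := by
        simpa using (hasDerivAt_id t).const_mul (-(-ω / 2))
      exact this.exp.const_mul n₀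
    · intro t ht hNt
      set β := n₀ * Real.exp (-(-ω / 2) * t) with hβ
      have hβ0 : 0 < β := by positivity
      have hβb : β ≤ b := by
        have : Real.exp (-(-ω / 2) * t) ≤ 1 := Real.exp_le_one_iff.2 (by nlinarith [ht.1])
        nlinarith
      have hnorm : a * ‖Z t‖ ≤ β := (hNa _).trans hNt.le
      have hnr : ‖Z t‖ ≤ r := by
        have := hnorm.trans (hβb.trans (min_le_left _ _))
        exact le_of_mul_le_mul_left this ha
      have h1 : N (f (Z t) - L (Z t)) ≤ C * (K * ‖Z t‖ ^ 2) :=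
        (hNC _).trans (mul_le_mul_of_nonneg_left
          (hf _ (hZ t (Set.Ico_subset_Icc_self ht)).1 hnr) hC.le)
      have h2 : ‖Z t‖ ^ 2 ≤ (β / a) ^ 2 := by
        have : ‖Z t‖ ≤ β / a := by rwa [le_div_iff₀ ha, mul_comm]
        gcongr
      have h3 : C * (K * (β / a) ^ 2) ≤ -ω / 4 * β := by
        have h4 : β ≤ -ω * a ^ 2 / (4 * C * K) := hβb.trans (min_le_right _ _)
        rw [le_div_iff₀ (by positivity)] at h4
        have h5 : C * (K * (β / a) ^ 2) = (β * (4 * C * K)) * (β / (4 * a ^ 2)) := by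
          field_simp
        rw [h5]
        calc _ ≤ (-ω * a ^ 2) * (β / (4 * a ^ 2)) := by gcongr
          _ = _ := by field_simp
      have h6 : C * (K * ‖Z t‖ ^ 2) ≤ C * (K * (β / a) ^ 2) := by gcongr
      change ω * N (Z t) + N (f (Z t) - L (Z t)) < n₀ * (Real.exp (-(-ω / 2) * t) * (-(-ω / 2)))
      have h7 : n₀ * (Real.exp (-(-ω / 2) * t) * (-(-ω / 2))) = β * (ω / 2) := by rw [hβ]; ring
      rw [h7, hNt]
      nlinarith
  intro t ht
  have hlt : C * ‖Z 0‖ < b := by rwa [lt_div_iff₀ hC, mul_comm] at hZ0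
  have hexp : Real.exp (-(-ω / 2) * t) ≤ 1 := Real.exp_le_one_iff.2 (by nlinarith [ht.1])
  have hmain : a * ‖Z t‖ ≤ C * ‖Z 0‖ * Real.exp (-(-ω / 2) * t) := by
    -- The barrier needs a positive initial value, so it starts slightly above `C * ‖Z 0‖`; this
    -- also covers `Z 0 = 0`.
    refine le_of_forall_pos_le_add fun ε hε => ?_
    have hs0 : 0 < min ε (b - C * ‖Z 0‖) := lt_min hε (by linarith)
    have h1 := key (C * ‖Z 0‖ + min ε (b - C * ‖Z 0‖)) (by positivity)
      ((hNC _).trans (by linarith)) (by linarith [min_le_right ε (b - C * ‖Z 0‖)]) t ht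
    have h2 : min ε (b - C * ‖Z 0‖) * Real.exp (-(-ω / 2) * t) ≤ ε := by
      calc _ ≤ min ε (b - C * ‖Z 0‖) * 1 := by gcongr
        _ ≤ ε := by rw [mul_one]; exact min_le_left _ _
    rw [add_mul] at h1
    linarith [hNa (Z t)]
  calc ‖Z t‖ ≤ C * ‖Z 0‖ * Real.exp (-(-ω / 2) * t) / a := by rwa [le_div_iff₀ ha, mul_comm]
    _ = _ := by ring

lemma mem_stateSpace_of_hasDerivWithinAt {Na No : ℕ} {Z Z' : ℝ → State Na No} {T : ℝ}
    (h0 : Z 0 ∈ stateSpace Na No) (hZ' : ∀ t, Z' t ∈ stateSpace Na No)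
    (hZ : ∀ t ∈ Set.Icc 0 T, HasDerivWithinAt Z (Z' t) (Set.Icc 0 T) t) :
    ∀ t ∈ Set.Icc 0 T, Z t ∈ stateSpace Na No := by
  intro t ht i
  have hd : ∀ s ∈ Set.Icc 0 T, HasDerivWithinAt (fun s => ∑ j, Z s i j) 0 (Set.Icc 0 T) s := by
    intro s hs
    have h1 : HasDerivWithinAt (fun s => ∑ j, Z s i j) (∑ j, Z' s i j) (Set.Icc 0 T) s :=
      HasDerivWithinAt.fun_sum fun j _ => by
        have := hasDerivWithinAt_pi.1 (hasDerivWithinAt_pi.1 (hZ s hs) i) j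
        exact this
    have h2 : ∑ j, Z' s i j = 0 := hZ' s i
    rwa [h2] at h1
  have := constant_of_has_deriv_right_zero (fun s hs => (hd s hs).continuousWithinAt)
    (fun s hs => hasDerivWithinAt_Ici_of_Icc hs (hd s (Set.Ico_subset_Icc_self hs))) t ht
  change ∑ j, Z t i j = 0
  rw [this]
  exact h0 i

/-- A continuously differentiable vector field with values in the state space agrees on any ball
with a vector field all of whose solutions exist for arbitrarily long times. -/
lemma exists_global_solutions {Na No : ℕ} {f : State Na No → State Na No} (hf : ContDiff ℝ 1 f)
    (hfV : ∀ Z, f Z ∈ stateSpace Na No) {R : ℝ} (hR : 0 ≤ R) :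
    ∃ g : State Na No → State Na No, (∀ Z, ‖Z‖ ≤ R → g Z = f Z) ∧
      ∀ Z₀ ∈ stateSpace Na No, ∀ T, 0 < T → ∃ Z : ℝ → State Na No, Z 0 = Z₀ ∧
        ∀ t ∈ Set.Icc 0 T, Z t ∈ stateSpace Na No ∧
          HasDerivWithinAt Z (g (Z t)) (Set.Icc 0 T) t := by
  -- Clamping every entry to `[-R, R]` makes `f ∘ κ` bounded and globally Lipschitz, while its
  -- values still lie in the state space.
  set κ : State Na No → State Na No := fun Z i j => max (-R) (min (Z i j) R) with hκ
  have hκR : ∀ Z, κ Z ∈ Metric.closedBall (0 : State Na No) R := by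
    intro Z
    rw [mem_closedBall_zero_iff]
    refine norm_le_of_abs_apply_le hR fun i j => abs_le.2 ⟨le_max_left _ _, ?_⟩
    exact max_le (by linarith) (min_le_right _ _)
  have hκid : ∀ Z, ‖Z‖ ≤ R → κ Z = Z := by
    intro Z hZ
    ext i j
    have := abs_le.1 ((abs_apply_le_norm Z i j).trans hZ)
    simp [hκ, this.1, this.2]
  have hκl : LipschitzWith 1 κ := by
    refine LipschitzWith.of_dist_le_mul fun Y Z => ?_
    rw [NNReal.coe_one, one_mul, dist_eq_norm]
    refine norm_le_of_abs_apply_le dist_nonneg fun i j => ?_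
    have h1 : LipschitzWith 1 fun x : ℝ => max (-R) (min x R) :=
      (LipschitzWith.id.min_const R).const_max (-R)
    have h2 := h1.dist_le_mul (Y i j) (Z i j)
    rw [NNReal.coe_one, one_mul, Real.dist_eq, Real.dist_eq] at h2
    refine h2.trans ?_
    rw [dist_eq_norm]
    exact abs_apply_le_norm (Y - Z) i j
  obtain ⟨K, hK⟩ := (hf.locallyLipschitz.locallyLipschitzOn
    (s := Metric.closedBall (0 : State Na No) R)).exists_lipschitzOnWith_of_compact
      (isCompact_closedBall _ _)
  obtain ⟨M, hM⟩ := (isCompact_closedBall (0 : State Na No) R).exists_bound_of_continuousOn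
    hf.continuous.continuousOn
  have hM0 : 0 ≤ M := (norm_nonneg _).trans (hM 0 (by simpa using hR))
  refine ⟨f ∘ κ, fun Z hZ => by rw [Function.comp_apply, hκid Z hZ], fun Z₀ hZ₀ T hT => ?_⟩
  have hl : LipschitzWith (K * 1) (f ∘ κ) := by
    rw [← lipschitzOnWith_univ]
    exact hK.comp hκl.lipschitzOnWith fun Z _ => hκR Z
  -- The radius `M * T` bounds the displacement over the whole interval, so one Picard–Lindelöf
  -- application reaches time `T`.
  have hpl : IsPicardLindelof (fun _ => f ∘ κ) (tmin := 0) (tmax := T) ⟨0, le_rfl, hT.le⟩ Z₀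
      (M.toNNReal * T.toNNReal) 0 M.toNNReal (K * 1) := by
    refine IsPicardLindelof.of_time_independent (fun Z _ => ?_) hl.lipschitzOnWith ?_
    · rw [Real.coe_toNNReal _ hM0]
      exact hM _ (hκR Z)
    · simp [hT.le]
  obtain ⟨Z, hZ0, hZ⟩ := hpl.exists_eq_forall_mem_Icc_hasDerivWithinAt₀
  refine ⟨Z, hZ0, fun t ht => ⟨?_, hZ t ht⟩⟩
  refine mem_stateSpace_of_hasDerivWithinAt (Z' := fun t => f (κ (Z t))) ?_
    (fun t => hfV _) hZ t ht
  rw [hZ0]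
  exact hZ₀

/-- Linearized instability: along an unstable eigenvector whose growth rate `μ` dominates half the
growth rate of the linear flow, solutions leave a fixed ball. -/
lemma not_lyapunovStable_of_linearization {Na No : ℕ} {f : State Na No → State Na No}
    (L : State Na No →ₗ[ℝ] State Na No) (N : Seminorm ℝ (State Na No)) {h a C ω μ K r : ℝ}
    (hh : 0 < h) (ha : 0 < a) (hC : 0 < C) (hNa : ∀ Z, a * ‖Z‖ ≤ N Z)
    (hNC : ∀ Z, N Z ≤ C * ‖Z‖) (hN : ∀ Z, N (Z + h • L Z) ≤ (1 + h * ω) * N Z) (hμ : 0 < μ)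
    (hω : ω < 2 * μ) (hK : 0 < K) (hr : 0 < r)
    (hf : ∀ Z ∈ stateSpace Na No, ‖Z‖ ≤ r → ‖f Z - L Z‖ ≤ K * ‖Z‖ ^ 2)
    (hfd : ContDiff ℝ 1 f) (hfV : ∀ Z, f Z ∈ stateSpace Na No) {e : State Na No}
    (he : e ∈ stateSpace Na No) (he1 : ‖e‖ = 1) (hLe : L e = μ • e) : ¬ LyapunovStable f := by
  intro hstab
  -- With this `A` the barrier `A x ^ 2`, `x = s exp (μ t)`, grows strictly faster than the error:
  -- `ω A + 4 C K < 2 μ A`.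
  set A := 4 * C * K / (2 * μ - ω) + 1 with hA
  have hA0 : 0 < A := by
    have : 0 < 4 * C * K / (2 * μ - ω) := div_pos (by positivity) (by linarith)
    linarith
  have hA1 : 4 * C * K < A * (2 * μ - ω) := by
    rw [hA, add_mul, div_mul_cancel₀ _ (by linarith)]
    linarith
  -- Up to amplitude `τ` the solution stays in the ball of radius `r`, and the quadratic error is at
  -- most half the linear growth.
  set τ := min (r / 2) (a / (2 * A)) with hτ
  have hτ0 : 0 < τ := lt_min (by positivity) (by positivity)
  have hτr : 2 * τ ≤ r := by
    have : τ ≤ r / 2 := min_le_left _ _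
    linarith
  have hτA : A * τ ≤ a / 2 := by
    have : τ ≤ a / (2 * A) := min_le_right _ _
    rw [le_div_iff₀ (by positivity)] at this
    linarith
  obtain ⟨g, hgf, hg⟩ := exists_global_solutions hfd hfV hr.le
  obtain ⟨ρ, hρ, hst⟩ := hstab (τ / 2) (by positivity)
  set s := min (ρ / 2) (τ / 2) with hs
  have hs0 : 0 < s := lt_min (by positivity) (by positivity)
  have hsρ : s < ρ := (min_le_left _ _).trans_lt (by linarith)
  have hsτ : s < τ := (min_le_right _ _).trans_lt (by linarith)
  -- The time at which the linear solution has grown from norm `s` to norm `τ`. The error is then at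
  -- most `τ / 2`, so the true solution has norm at least `τ / 2`, contrary to stability.
  set T := Real.log (τ / s) / μ with hT
  have hT0 : 0 < T := div_pos (Real.log_pos ((one_lt_div hs0).2 hsτ)) hμ
  have hTτ : s * Real.exp (μ * T) = τ := by
    rw [hT, mul_div_cancel₀ _ hμ.ne', Real.exp_log (by positivity), mul_div_cancel₀ _ hs0.ne']
  obtain ⟨Z, hZ0, hZ⟩ := hg (s • e) (fun i => (optionSpace No).smul_mem s (he i)) T hT0
  set E : ℝ → State Na No := fun t => Z t - (s * Real.exp (μ * t)) • e with hE
  have hexp : ∀ t, HasDerivAt (fun t => s * Real.exp (μ * t)) (μ * (s * Real.exp (μ * t))) t := by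
    intro t
    have : HasDerivAt (fun t : ℝ => μ * t) μ t := by
      simpa using (hasDerivAt_id t).const_mul μ
    refine (this.exp.const_mul s).congr_deriv (by ring)
  have hEd : ∀ t ∈ Set.Icc 0 T, HasDerivWithinAt E (L (E t) + (g (Z t) - L (Z t)))
      (Set.Icc 0 T) t := by
    intro t ht
    refine ((hZ t ht).2.sub ((hexp t).hasDerivWithinAt.smul_const e)).congr_deriv ?_
    simp only [hE, map_sub, map_smul, hLe]
    module
  have hsmall : ∀ t ∈ Set.Icc 0 T, s * Real.exp (μ * t) ≤ τ := by
    intro t ht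
    rw [← hTτ]
    have := ht.2
    gcongr
  have hEZ : ∀ t ∈ Set.Icc 0 T, N (E t) ≤ A * (s * Real.exp (μ * t)) ^ 2 →
      ‖E t‖ ≤ s * Real.exp (μ * t) / 2 := by
    intro t ht hNt
    set x := s * Real.exp (μ * t) with hx
    have hx0 : 0 < x := by positivity
    have h1 : a * ‖E t‖ ≤ a * (x / 2) := by
      calc a * ‖E t‖ ≤ A * x ^ 2 := (hNa _).trans hNt
        _ = A * x * x := by ring
        _ ≤ A * τ * x := by
          have := hsmall t ht
          gcongr
        _ ≤ a / 2 * x := by gcongr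
        _ = _ := by ring
    exact le_of_mul_le_mul_left h1 ha
  have hZle : ∀ t ∈ Set.Icc 0 T, N (E t) ≤ A * (s * Real.exp (μ * t)) ^ 2 →
      ‖Z t‖ ≤ 2 * (s * Real.exp (μ * t)) := by
    intro t ht hNt
    have h1 := hEZ t ht hNt
    have h2 : Z t = E t + (s * Real.exp (μ * t)) • e := by simp [hE]
    have h3 : ‖(s * Real.exp (μ * t)) • e‖ = s * Real.exp (μ * t) := by
      rw [norm_smul, he1, mul_one, Real.norm_of_nonneg (by positivity)]
    have h4 : 0 < s * Real.exp (μ * t) := by positivity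
    rw [h2]
    refine (norm_add_le _ _).trans ?_
    rw [h3]
    linarith
  have key : ∀ t ∈ Set.Icc 0 T, N (E t) ≤ A * (s * Real.exp (μ * t)) ^ 2 := by
    refine image_le_of_liminf_slope_right_lt_deriv_boundary
      (f := fun t => N (E t)) (f' := fun t => ω * N (E t) + N (g (Z t) - L (Z t)))
      (B' := fun t => 2 * μ * (A * (s * Real.exp (μ * t)) ^ 2))
      ((N.continuous_of_le_mul_norm hNC).comp_continuousOn fun t ht =>
        (hEd t ht).continuousWithinAt) ?_ ?_ ?_ ?_
    · intro t ht q hq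
      refine (N.eventually_slope_lt L hh hC hNC hN (X := E) ?_ hq).frequently
      exact hasDerivWithinAt_Ici_of_Icc ht (hEd t (Set.Ico_subset_Icc_self ht))
    · have : E 0 = 0 := by simp [hE, hZ0]
      rw [this, map_zero]
      positivity
    · intro t
      refine (((hexp t).pow 2).const_mul A).congr_deriv ?_
      simp
      ring
    · intro t ht hNt
      have ht' := Set.Ico_subset_Icc_self ht
      have h1 := hZle t ht' hNt.le
      set x := s * Real.exp (μ * t) with hx
      have hx0 : 0 < x := by positivity
      have h2 : ‖Z t‖ ≤ r := by linarith [hsmall t ht']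
      have h3 : N (g (Z t) - L (Z t)) ≤ C * (K * (2 * x) ^ 2) := by
        rw [hgf _ h2]
        refine (hNC _).trans (mul_le_mul_of_nonneg_left ((hf _ (hZ t ht').1 h2).trans ?_) hC.le)
        gcongr
      have h4 : 4 * C * K * x ^ 2 < A * (2 * μ - ω) * x ^ 2 := by gcongr
      change ω * N (E t) + N (g (Z t) - L (Z t)) < 2 * μ * (A * x ^ 2)
      rw [hNt]
      nlinarith
  have hsol : IsSolution f T Z := by
    intro t ht
    have h1 : ‖Z t‖ ≤ r := by linarith [hZle t ht (key t ht), hsmall t ht]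
    refine ⟨(hZ t ht).1, ?_⟩
    rw [← hgf _ h1]
    exact (hZ t ht).2
  have hTmem : T ∈ Set.Icc 0 T := ⟨hT0.le, le_rfl⟩
  have h1 := hst T Z hT0 hsol (by
    rw [hZ0, norm_smul, he1, mul_one, Real.norm_of_nonneg hs0.le]; exact hsρ) T hTmem
  have h2 := hEZ T hTmem (key T hTmem)
  rw [hTτ] at h2
  have h3 : ‖τ • e‖ = τ := by rw [norm_smul, he1, mul_one, Real.norm_of_nonneg hτ0.le]
  have h4 : τ • e = Z T - E T := by simp [hE, hTτ]
  have h5 : τ ≤ ‖Z T‖ + ‖E T‖ := by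
    rw [← h3, h4]
    exact norm_sub_le _ _
  linarith

/-- The affine matrix has the same eigenvectors as `A`. Bounding `g * ξ.re` rather than `ξ.re`
covers both signs of `g`. -/
lemma eigenvalues_re_le_of_smul_one_add {n : ℕ} {A : Matrix (Fin n) (Fin n) ℝ} {a g m : ℝ}
    (hg : g ≠ 0) (hA : ∀ ξ ∈ eigenvalues A, g * ξ.re ≤ m) :
    ∀ ξ ∈ eigenvalues (a • 1 + g • A), ξ.re ≤ a + m := by
  intro ξ hξ
  obtain ⟨z, hz, h⟩ := exists_eigenvector_of_mem_eigenvalues hξ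
  have hg' : (g : ℂ) ≠ 0 := by exact_mod_cast hg
  have hmap : (a • 1 + g • A).map (algebraMap ℝ ℂ) =
      (a : ℂ) • 1 + (g : ℂ) • A.map (algebraMap ℝ ℂ) := by
    ext i j
    by_cases hij : i = j <;> simp [hij]
  rw [hmap, Matrix.add_mulVec, Matrix.smul_mulVec, Matrix.one_mulVec, Matrix.smul_mulVec] at h
  have h1 : A.map (algebraMap ℝ ℂ) *ᵥ z = ((ξ - a) / g) • z := by
    have h2 : (g : ℂ) • (A.map (algebraMap ℝ ℂ) *ᵥ z) = (ξ - a) • z := by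
      rw [sub_smul, ← h]
      abel
    rw [div_eq_inv_mul, ← smul_smul, ← h2, smul_smul, inv_mul_cancel₀ hg', one_smul]
  have h3 := hA _ (mem_eigenvalues_of_eigenvector hz h1)
  have h4 : ((ξ - a) / g : ℂ).re = (ξ.re - a) / g := by
    rw [Complex.div_ofReal_re]
    simp
  rw [h4, mul_div_cancel₀ _ hg] at h3
  linarith

/-! ### A branch of equilibria along the axial option vector -/

/-- Hadamard's lemma in one variable, with a strictly differentiable quotient. -/
lemma exists_quotient_hasStrictDerivAt {f : ℝ → ℝ} (hf : ContDiff ℝ 2 f) (h0 : f 0 = 0) :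
    ∃ (q : ℝ → ℝ) (q' : ℝ), (∀ t, f t = t * q t) ∧ q 0 = deriv f 0 ∧ HasStrictDerivAt q q' 0 := by
  have hf' : ContDiff ℝ 1 (deriv f) := hf.deriv'
  have hd := (hf'.contDiffAt (x := 0)).hasStrictDerivAt one_ne_zero
  have hint : ∀ t, IntervalIntegrable (fun τ => deriv f (τ * t)) MeasureTheory.volume 0 1 :=
    fun t => (hf'.continuous.comp (by fun_prop)).intervalIntegrable 0 1
  set b := deriv (deriv f) 0
  -- The quotient averages `deriv f` over the segment from `0` to `t`; its derivative at `0` carries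
  -- the factor `∫ τ = 1 / 2`.
  refine ⟨fun t => ∫ τ in (0 : ℝ)..1, deriv f (τ * t), b / 2, fun t => ?_, by simp, ?_⟩
  · rw [intervalIntegral.mul_integral_comp_mul_right, intervalIntegral.integral_deriv_eq_sub]
    · simp [h0]
    · exact fun x _ => (hf.differentiable (by norm_num)) x
    · exact hf'.continuous.intervalIntegrable _ _
  · rw [hasStrictDerivAt_iff_hasStrictFDerivAt]
    refine HasStrictFDerivAt.of_isLittleO (Asymptotics.isLittleO_iff.2 fun ε hε => ?_)
    have ho := hd.isLittleO.def hε
    rw [nhds_prod_eq] at ho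
    obtain ⟨r, hr, hball⟩ := Metric.eventually_nhds_iff_ball.1 (by rwa [← nhds_prod_eq] at ho)
    filter_upwards [Metric.ball_mem_nhds ((0 : ℝ), (0 : ℝ)) hr] with p hp
    have hid : IntervalIntegrable (fun τ : ℝ => τ * ((p.1 - p.2) * b)) MeasureTheory.volume 0 1 :=
      (by fun_prop : Continuous fun τ : ℝ => τ * ((p.1 - p.2) * b)).intervalIntegrable 0 1
    have h1 : (∫ τ in (0 : ℝ)..1, deriv f (τ * p.1)) - (∫ τ in (0 : ℝ)..1, deriv f (τ * p.2)) -
        (p.1 - p.2) * (b / 2) =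
        ∫ τ in (0 : ℝ)..1, (deriv f (τ * p.1) - deriv f (τ * p.2) - τ * ((p.1 - p.2) * b)) := by
      rw [intervalIntegral.integral_sub ((hint _).sub (hint _)) hid,
        intervalIntegral.integral_sub (hint _) (hint _), intervalIntegral.integral_mul_const,
        integral_id]
      ring
    have h2 := intervalIntegral.norm_integral_le_of_norm_le_const (a := (0 : ℝ)) (b := 1)
      (f := fun τ => deriv f (τ * p.1) - deriv f (τ * p.2) - τ * ((p.1 - p.2) * b))
      (C := ε * ‖p.1 - p.2‖) (fun τ hτ => by
        rw [Set.uIoc_of_le zero_le_one] at hτ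
        have hτ1 : ‖τ‖ ≤ 1 := by rw [Real.norm_of_nonneg hτ.1.le]; exact hτ.2
        have h3 : τ • p ∈ Metric.ball ((0 : ℝ), (0 : ℝ)) r := by
          have h4 : ‖p‖ < r := mem_ball_zero_iff.1 hp
          change τ • p ∈ Metric.ball (0 : ℝ × ℝ) r
          rw [mem_ball_zero_iff, norm_smul]
          exact (mul_le_of_le_one_left (norm_nonneg p) hτ1).trans_lt h4
        have h5 := hball _ h3
        have h6 : ‖(τ • p).1 - (τ • p).2‖ ≤ ‖p.1 - p.2‖ := by
          rw [Prod.smul_fst, Prod.smul_snd, ← smul_sub, norm_smul]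
          exact mul_le_of_le_one_left (norm_nonneg _) hτ1
        refine le_trans (le_of_eq ?_) (h5.trans (mul_le_mul_of_nonneg_left h6 hε.le))
        congr 1
        simp
        ring)
    rw [sub_zero, abs_one, mul_one, ← h1] at h2
    simpa using h2

/-- The option vector in which all options but the first one are equivalent. -/
def axial (No : ℕ) : Fin No → ℝ := fun j => if j.1 = 0 then No - 1 else -1

lemma sum_ite_first {No : ℕ} (hNo : 0 < No) (a b : ℝ) :
    ∑ j : Fin No, (if j.1 = 0 then a else b) = a + (No - 1) * b := by
  obtain ⟨n, rfl⟩ : ∃ n, No = n + 1 := ⟨No - 1, by omega⟩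
  rw [Fin.sum_univ_succ]
  simp

lemma axial_mem {No : ℕ} (hNo : 0 < No) : axial No ∈ optionSpace No := by
  change ∑ j : Fin No, (if j.1 = 0 then (No : ℝ) - 1 else -1) = 0
  rw [sum_ite_first hNo]
  ring

lemma axial_ne_zero {No : ℕ} (hNo : 2 ≤ No) : axial No ≠ 0 := by
  intro h
  have := congrFun h ⟨1, hNo⟩
  simp [axial] at this

lemma act_tensor_eq {Na No : ℕ} (M : Matrix (Fin Na) (Fin Na) ℝ) (x : Fin Na → ℝ)
    (w : Fin No → ℝ) : act M (tensor x w) = tensor (M *ᵥ x) w := by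
  ext i j
  simp only [act_apply, tensor, Matrix.mulVec, dotProduct, Finset.sum_mul, mul_assoc]

/-- The response of a saturating function along the axial direction. -/
noncomputable def axialResponse (No : ℕ) (S : ℝ → ℝ) : ℝ → ℝ :=
  fun t => (S ((No - 1) * t) - S (-t)) / No

lemma axialResponse_zero (No : ℕ) {S : ℝ → ℝ} : axialResponse No S 0 = 0 := by
  simp [axialResponse]

lemma contDiff_axialResponse (No : ℕ) {S : ℝ → ℝ} (hS : ContDiff ℝ 2 S) :
    ContDiff ℝ 2 (axialResponse No S) :=
  ((hS.comp (contDiff_const.mul contDiff_id)).sub (hS.comp contDiff_neg)).div_const _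

lemma deriv_axialResponse {No : ℕ} (hNo : 0 < No) {S : ℝ → ℝ} (hS : DifferentiableAt ℝ S 0) :
    deriv (axialResponse No S) 0 = deriv S 0 := by
  have hNo' : (No : ℝ) ≠ 0 := by positivity
  have h1 : HasDerivAt (fun t : ℝ => S ((No - 1) * t)) (deriv S 0 * (No - 1)) 0 := by
    have h2 : HasDerivAt (fun t : ℝ => ((No : ℝ) - 1) * t) (No - 1) 0 := by
      simpa using (hasDerivAt_id (0 : ℝ)).const_mul ((No : ℝ) - 1)
    refine HasDerivAt.comp 0 ?_ h2
    simpa using hS.hasDerivAt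
  have h3 : HasDerivAt (fun t : ℝ => S (-t)) (deriv S 0 * -1) 0 := by
    refine HasDerivAt.comp 0 ?_ (hasDerivAt_neg 0)
    simpa using hS.hasDerivAt
  have h4 := ((h1.sub h3).div_const (No : ℝ)).deriv
  change deriv (fun t => (S ((No - 1) * t) - S (-t)) / No) 0 = _
  refine h4.trans ?_
  field_simp
  ring

/-- On states along the axial option vector the dynamics reduces to one scalar per agent. -/
lemma field_tensor_axial {Na No : ℕ} (hNo : 0 < No) (S₁ S₂ : ℝ → ℝ)
    (P Q : Matrix (Fin Na) (Fin Na) ℝ) (d u : ℝ) (x : Fin Na → ℝ) :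
    field S₁ S₂ P Q d u (tensor x (axial No)) =
      tensor (fun i => -d * x i + u * (axialResponse No S₁ ((P *ᵥ x) i) -
        axialResponse No S₂ ((Q *ᵥ x) i))) (axial No) := by
  ext i j
  have hNo' : (No : ℝ) ≠ 0 := by positivity
  have hrow : (fun j : Fin No => -d * tensor x (axial No) i j +
      u * (S₁ (act P (tensor x (axial No)) i j) - S₂ (act Q (tensor x (axial No)) i j))) =
      fun j : Fin No => if j.1 = 0 then
        -d * (x i * (No - 1)) + u * (S₁ ((No - 1) * (P *ᵥ x) i) - S₂ ((No - 1) * (Q *ᵥ x) i))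
        else -d * (x i * -1) + u * (S₁ (-(P *ᵥ x) i) - S₂ (-(Q *ᵥ x) i)) := by
    ext j
    rw [act_tensor_eq, act_tensor_eq]
    simp only [tensor, axial]
    split_ifs
    · simp only [mul_comm]
    · simp only [mul_neg, mul_one]
  rw [field, projState_apply, hrow]
  simp only [P0, sum_ite_first hNo, tensor, axial, axialResponse]
  split_ifs
  · field_simp
    ring
  · field_simp
    ring

/-- Strict differentiability of `q` at `0` alone suffices, because its argument vanishes at a point
of zero amplitude `σ`. -/
lemma hasStrictFDerivAt_mul_quotient {E : Type*} [NormedAddCommGroup E] [NormedSpace ℝ E]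
    (a σ : E →L[ℝ] ℝ) {q : ℝ → ℝ} {q' : ℝ} (hq : HasStrictDerivAt q q' 0) {z : E}
    (hσ : σ z = 0) :
    HasStrictFDerivAt (fun y => a y * q (σ y * a y)) (q 0 • a + (a z ^ 2 * q') • σ) z := by
  have h1 : HasStrictFDerivAt (fun y => σ y * a y) (σ z • a + a z • σ) z :=
    σ.hasStrictFDerivAt.mul a.hasStrictFDerivAt
  have h2 : HasStrictDerivAt q q' (σ z * a z) := by rwa [hσ, zero_mul]
  have h3 := a.hasStrictFDerivAt (x := z) |>.mul (h2.comp_hasStrictFDerivAt z h1)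
  refine h3.congr_fderiv ?_
  ext y
  simp [hσ]
  ring

lemma hasStrictFDerivAt_scalar_equation {E : Type*} [NormedAddCommGroup E] [NormedSpace ℝ E]
    (a b σ υ ξ : E →L[ℝ] ℝ) (d : ℝ) {q₁ q₂ : ℝ → ℝ} {q₁' q₂' : ℝ} (hq₁ : HasStrictDerivAt q₁ q₁' 0)
    (hq₂ : HasStrictDerivAt q₂ q₂' 0) (h₁ : q₁ 0 = 1) (h₂ : q₂ 0 = 1) {z : E} (hσ : σ z = 0) :
    HasStrictFDerivAt
      (fun y => -d * ξ y + υ y * (a y * q₁ (σ y * a y) - b y * q₂ (σ y * b y)))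
      (-d • ξ + (υ z • ((a + (a z ^ 2 * q₁') • σ) - (b + (b z ^ 2 * q₂') • σ)) +
        (a z - b z) • υ)) z := by
  have h := (hasStrictFDerivAt_mul_quotient a σ hq₁ hσ).sub
    (hasStrictFDerivAt_mul_quotient b σ hq₂ hσ)
  refine ((ξ.hasStrictFDerivAt.const_mul (-d)).add (υ.hasStrictFDerivAt.mul h)).congr_fderiv ?_
  simp only [Pi.sub_apply, hσ, h₁, h₂, zero_mul, mul_one, one_smul]

lemma hasDerivAt_id_smul_of_continuousAt {E : Type*} [NormedAddCommGroup E] [NormedSpace ℝ E]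
    {F : ℝ → E} (hF : ContinuousAt F 0) : HasDerivAt (fun s => s • F s) (F 0) 0 := by
  rw [hasDerivAt_iff_tendsto_slope]
  refine Filter.Tendsto.congr' ?_ (hF.tendsto.mono_left nhdsWithin_le_nhds)
  filter_upwards [self_mem_nhdsWithin] with s hs
  have hs' : s ≠ 0 := hs
  simp [slope_def_module, smul_smul, hs']

/-- **Bifurcation from a simple eigenvalue**, along the axial option vector. -/
lemma exists_branch {Na No : ℕ} (hNo : 2 ≤ No) {S₁ S₂ : ℝ → ℝ} (hS₁ : IsSaturating S₁)
    (hS₂ : IsSaturating S₂) {P Q : Matrix (Fin Na) (Fin Na) ℝ} {d u c : ℝ} {v ℓ : Fin Na → ℝ}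
    (hv : (P - Q) *ᵥ v = c • v) (hℓ : ℓ ᵥ* (P - Q) = c • ℓ) (hℓv : ℓ ⬝ᵥ v = 1)
    (hker : ∀ y, (P - Q) *ᵥ y = c • y → ∃ t : ℝ, y = t • v) (hc : c ≠ 0) (hu : u ≠ 0)
    (huc : u * c = d) :
    ∃ w ∈ optionSpace No, w ≠ 0 ∧ ∃ s₀ U Z, IsBranch (field S₁ S₂ P Q d) u s₀ U Z ∧
      HasDerivWithinAt Z (tensor v w) (Set.Ici 0) 0 := by
  have hNo0 : 0 < No := by omega
  have hquot : ∀ S, IsSaturating S → ∃ (q : ℝ → ℝ) (q' : ℝ),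
      (∀ t, axialResponse No S t = t * q t) ∧ q 0 = 1 ∧ HasStrictDerivAt q q' 0 := by
    intro S hS
    obtain ⟨q, q', h1, h2, h3⟩ := exists_quotient_hasStrictDerivAt
      (contDiff_axialResponse No (hS.contDiff.of_le (by norm_num))) (axialResponse_zero No)
    refine ⟨q, q', h1, ?_, h3⟩
    rw [h2, deriv_axialResponse hNo0 (hS.contDiff.differentiable (by norm_num) 0), hS.deriv_zero]
  obtain ⟨q₁, q₁', hq₁, hq₁0, hq₁'⟩ := hquot S₁ hS₁
  obtain ⟨q₂, q₂', hq₂, hq₂0, hq₂'⟩ := hquot S₂ hS₂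
  -- The coordinates are amplitude `s`, attention `u` and agent profile `x`; the equilibrium sought
  -- is `s • (x ⊗ axial)`.
  let E := ℝ × ℝ × (Fin Na → ℝ)
  let σ : E →L[ℝ] ℝ := ContinuousLinearMap.fst ℝ ℝ (ℝ × (Fin Na → ℝ))
  let υ : E →L[ℝ] ℝ := (ContinuousLinearMap.fst ℝ ℝ (Fin Na → ℝ)).comp
    (ContinuousLinearMap.snd ℝ ℝ (ℝ × (Fin Na → ℝ)))
  let χ : E →L[ℝ] (Fin Na → ℝ) := (ContinuousLinearMap.snd ℝ ℝ (Fin Na → ℝ)).comp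
    (ContinuousLinearMap.snd ℝ ℝ (ℝ × (Fin Na → ℝ)))
  let row : (Fin Na → ℝ) → E →L[ℝ] ℝ := fun m =>
    (LinearMap.toContinuousLinearMap (dotProductBilin ℝ ℝ m)).comp χ
  have hrow : ∀ m z, row m z = m ⬝ᵥ z.2.2 := fun m z => rfl
  -- The equilibrium equation divided by the amplitude, which removes the trivial solution and stays
  -- regular at `s = 0`.
  let H : E → Fin Na → ℝ := fun z i => -d * z.2.2 i +
    z.2.1 * (row (P i) z * q₁ (σ z * row (P i) z) - row (Q i) z * q₂ (σ z * row (Q i) z))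
  let z₀ : E := (0, u, v)
  let H' : E →L[ℝ] (Fin Na → ℝ) := ContinuousLinearMap.pi fun i =>
    -d • (ContinuousLinearMap.proj i).comp χ +
      (u • ((row (P i) + (row (P i) z₀ ^ 2 * q₁') • σ) - (row (Q i) + (row (Q i) z₀ ^ 2 * q₂') • σ))
        + (row (P i) z₀ - row (Q i) z₀) • υ)
  have hH : HasStrictFDerivAt H H' z₀ := by
    refine hasStrictFDerivAt_pi.2 fun i => ?_
    exact hasStrictFDerivAt_scalar_equation (row (P i)) (row (Q i)) σ υ
      ((ContinuousLinearMap.proj i).comp χ) d hq₁' hq₂' hq₁0 hq₂0 (z := z₀) rfl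
  -- Adjoining the amplitude and the normalization `ℓ ⬝ᵥ x` equates source and target dimensions, so
  -- the inverse function theorem can be applied at `(0, u, v)`; the branch is the preimage of `(s,
  -- 1, 0)`.
  let Φ' : E →L[ℝ] E := σ.prod ((row ℓ).prod H')
  have hΦ : HasStrictFDerivAt (fun z => (σ z, row ℓ z, H z)) Φ' z₀ :=
    σ.hasStrictFDerivAt.prodMk ((row ℓ).hasStrictFDerivAt.prodMk hH)
  have hinj : Function.Injective Φ' := by
    refine (injective_iff_map_eq_zero Φ').2 ?_
    rintro ⟨s, t, x⟩ hz
    have hs : s = 0 := congrArg Prod.fst hz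
    have hx : ℓ ⬝ᵥ x = 0 := congrArg (fun z : E => z.2.1) hz
    have h1 : ∀ i, -d * x i + (u * (((P - Q) *ᵥ x) i) + ((P - Q) *ᵥ v) i * t) = 0 := by
      intro i
      have h2 : -d * x i + (u * (((P *ᵥ x) i + ((P *ᵥ v) i ^ 2 * q₁') * s) -
          ((Q *ᵥ x) i + ((Q *ᵥ v) i ^ 2 * q₂') * s)) + ((P *ᵥ v) i - (Q *ᵥ v) i) * t) = 0 :=
        congrFun (congrArg (fun z : E => z.2.2) hz) i
      rw [← h2, hs, Matrix.sub_mulVec, Matrix.sub_mulVec]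
      simp
    rw [hv] at h1
    have h2 : ℓ ⬝ᵥ ((P - Q) *ᵥ x) = 0 := by
      rw [Matrix.dotProduct_mulVec, hℓ, smul_dotProduct, hx, smul_zero]
    have h3 : (-d) • x + (u • ((P - Q) *ᵥ x) + (t * c) • v) = 0 := by
      ext i
      have := h1 i
      simp only [Pi.add_apply, Pi.smul_apply, smul_eq_mul, Pi.zero_apply] at this ⊢
      linarith
    -- Pairing with `ℓ` leaves only `t * c`: this is the transversal crossing of the eigenvalue in
    -- `u`.
    have ht : t = 0 := by
      have h4 := congrArg (fun y => ℓ ⬝ᵥ y) h3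
      simp only [dotProduct_add, dotProduct_smul, hx, h2, hℓv, mul_zero, zero_add, smul_eq_mul,
        mul_one, dotProduct_zero] at h4
      exact (mul_eq_zero.1 h4).resolve_right hc
    have hx0 : x = 0 := by
      rw [ht, zero_mul, zero_smul, add_zero, ← huc] at h3
      have h5 : (P - Q) *ᵥ x = c • x := by
        have h6 : u • ((P - Q) *ᵥ x) = u • (c • x) := by
          rw [smul_smul, eq_comm, ← sub_eq_zero, ← neg_eq_zero, ← h3]
          module
        exact smul_right_injective _ hu h6
      obtain ⟨r, rfl⟩ := hker x h5
      rw [dotProduct_smul, hℓv, smul_eq_mul, mul_one] at hx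
      rw [hx, zero_smul]
    rw [hs, ht, hx0]
    rfl
  let Ψ : E ≃L[ℝ] E :=
    (LinearEquiv.ofInjectiveEndo (Φ' : E →ₗ[ℝ] E) hinj).toContinuousLinearEquiv
  have hΦΨ : HasStrictFDerivAt (fun z => (σ z, row ℓ z, H z)) (Ψ : E →L[ℝ] E) z₀ := by
    refine hΦ.congr_fderiv ?_
    ext z <;> rfl
  have hΦ0 : ((σ z₀, row ℓ z₀, H z₀) : E) = (0, 1, 0) := by
    refine Prod.ext rfl (Prod.ext hℓv ?_)
    ext i
    have h1 := congrFun hv i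
    rw [Matrix.sub_mulVec] at h1
    have h2 : row (P i) z₀ - row (Q i) z₀ = c * v i := h1
    have h4 : σ z₀ = 0 := rfl
    have h3 : H z₀ i = -d * v i + u * (row (P i) z₀ - row (Q i) z₀) := by
      simp only [H, h4, zero_mul, hq₁0, hq₂0, mul_one]
      rfl
    change H z₀ i = 0
    rw [h3, h2, ← huc]
    ring
  set inv := hΦΨ.localInverse with hinv
  have hright := hΦΨ.eventually_right_inverse
  have hleft := hΦΨ.localInverse_apply_image
  have hstrict := hΦΨ.to_localInverse
  rw [hΦ0, ← hinv] at hright hleft hstrict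
  obtain ⟨K, N, hN, hlip⟩ := hstrict.exists_lipschitzOnWith
  have hcurve : Continuous fun s : ℝ => ((s, 1, 0) : E) := by fun_prop
  have hev : ∀ᶠ s in 𝓝 (0 : ℝ), ((s, 1, 0) : E) ∈ N ∧
      (σ (inv (s, 1, 0)), row ℓ (inv (s, 1, 0)), H (inv (s, 1, 0))) = ((s, 1, 0) : E) :=
    hcurve.continuousAt.eventually (Filter.Eventually.and hN hright)
  obtain ⟨s₀, hs₀, hball⟩ := Metric.eventually_nhds_iff_ball.1 hev
  have hIco : ∀ s ∈ Set.Ico 0 s₀, s ∈ Metric.ball (0 : ℝ) s₀ := fun s hs => by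
    rw [mem_ball_zero_iff, Real.norm_of_nonneg hs.1]
    exact hs.2
  have hcont : ContinuousOn (fun s : ℝ => inv (s, 1, 0)) (Metric.ball 0 s₀) :=
    hlip.continuousOn.comp hcurve.continuousOn fun s hs => (hball s hs).1
  have htens : Continuous fun x : Fin Na → ℝ => tensor x (axial No) :=
    continuous_pi fun i => continuous_pi fun j => (continuous_apply i).mul continuous_const
  have hF : ContinuousOn (fun s : ℝ => tensor (inv (s, 1, 0)).2.2 (axial No))
      (Metric.ball 0 s₀) :=
    htens.comp_continuousOn (continuous_snd.comp_continuousOn (continuous_snd.comp_continuousOn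
      hcont))
  refine ⟨axial No, axial_mem hNo0, axial_ne_zero hNo, s₀, fun s => (inv (s, 1, 0)).2.1,
    fun s => s • tensor (inv (s, 1, 0)).2.2 (axial No), ⟨hs₀, ?_, ?_, ?_, ?_, ?_⟩, ?_⟩
  · exact (continuous_fst.comp_continuousOn (continuous_snd.comp_continuousOn hcont)).mono hIco
  · exact (continuousOn_id.smul hF).mono hIco
  · rw [hleft]
  · rw [zero_smul]
  · intro s hs
    have h1 := (hball s (hIco s (Set.Ioo_subset_Ico_self hs))).2
    set z := inv (s, 1, 0) with hz
    have hσ : σ z = s := congrArg Prod.fst h1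
    have hℓz : ℓ ⬝ᵥ z.2.2 = 1 := congrArg (fun z : E => z.2.1) h1
    have hHz : H z = 0 := congrArg (fun z : E => z.2.2) h1
    have hsm : s • tensor z.2.2 (axial No) = tensor (s • z.2.2) (axial No) := by
      ext i j
      simp [tensor, mul_assoc]
    refine ⟨?_, ?_, ?_⟩
    · intro h0
      have h2 : tensor z.2.2 (axial No) = 0 := (smul_eq_zero.1 h0).resolve_left hs.1.ne'
      have h3 : z.2.2 = 0 := by
        ext i
        have h4 : z.2.2 i * axial No ⟨1, hNo⟩ = 0 := congrFun (congrFun h2 i) ⟨1, hNo⟩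
        simpa [axial] using h4
      rw [h3, dotProduct_zero] at hℓz
      exact zero_ne_one hℓz
    · rw [hsm]
      exact tensor_mem _ (axial_mem hNo0)
    · rw [hsm, field_tensor_axial hNo0]
      ext i j
      have h2 : H z i = 0 := congrFun hHz i
      have h3 : -d * z.2.2 i + z.2.1 * (row (P i) z * q₁ (σ z * row (P i) z) -
        row (Q i) z * q₂ (σ z * row (Q i) z)) = 0 := h2
      rw [hσ] at h3
      have hP : (P *ᵥ (s • z.2.2)) i = s * row (P i) z := by
        rw [Matrix.mulVec_smul]; rfl
      have hQ : (Q *ᵥ (s • z.2.2)) i = s * row (Q i) z := by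
        rw [Matrix.mulVec_smul]; rfl
      simp only [tensor, hP, hQ, hq₁, hq₂, Pi.smul_apply, smul_eq_mul, Pi.zero_apply]
      refine mul_eq_zero_of_left ?_ _
      linear_combination s * h3
  -- The branch is `s • F s`, so continuity of `F` at `0` with `F 0 = v ⊗ axial` already gives the
  -- tangent.
  · have h1 := hasDerivAt_id_smul_of_continuousAt
      (hF.continuousAt (Metric.ball_mem_nhds 0 hs₀))
    rw [hleft] at h1
    exact h1.hasDerivWithinAt

/-! ### Tangency to the kernel and the steady-state bifurcation -/

/-- The map `T` factors through the range of `S`, which is finite-dimensional, so the factor is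
bounded. Applied with `S` the critical Jacobian, it bounds the distance to the kernel. -/
lemma exists_norm_le_mul_norm_of_ker_le {E F G : Type*} [NormedAddCommGroup E] [NormedSpace ℝ E]
    [NormedAddCommGroup F] [NormedSpace ℝ F] [FiniteDimensional ℝ F] [NormedAddCommGroup G]
    [NormedSpace ℝ G] (S : E →ₗ[ℝ] F) (T : E →ₗ[ℝ] G) (h : ∀ x, S x = 0 → T x = 0) :
    ∃ C, 0 < C ∧ ∀ x, ‖T x‖ ≤ C * ‖S x‖ := by
  obtain ⟨r, hr⟩ := S.rangeRestrict.exists_rightInverse_of_surjective S.range_rangeRestrict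
  let T' := LinearMap.toContinuousLinearMap (T.comp r)
  refine ⟨‖T'‖ + 1, by positivity, fun x => ?_⟩
  have h1 : S (r (S.rangeRestrict x)) = S x :=
    congrArg Subtype.val (LinearMap.congr_fun hr (S.rangeRestrict x))
  have h2 : T x = T' (S.rangeRestrict x) := by
    have := h (x - r (S.rangeRestrict x)) (by rw [map_sub, h1, sub_self])
    rw [map_sub, sub_eq_zero] at this
    exact this
  calc ‖T x‖ ≤ ‖T'‖ * ‖S.rangeRestrict x‖ := by rw [h2]; exact T'.le_opNorm _
    _ = ‖T'‖ * ‖S x‖ := rfl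
    _ ≤ _ := by gcongr; linarith

/-- The coordinates of a state along a left eigenvector. -/
def coord {Na No : ℕ} (ℓ : Fin Na → ℝ) : State Na No →ₗ[ℝ] (Fin No → ℝ) where
  toFun Z := fun j => ∑ i, ℓ i * Z i j
  map_add' Y Z := by
    ext j
    simp [mul_add, Finset.sum_add_distrib]
  map_smul' c Z := by
    ext j
    simp only [Pi.smul_apply, smul_eq_mul, RingHom.id_apply, Finset.mul_sum]
    exact Finset.sum_congr rfl fun k _ => by ring

lemma coord_apply {Na No : ℕ} (ℓ : Fin Na → ℝ) (Z : State Na No) (j) :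
    coord ℓ Z j = ∑ i, ℓ i * Z i j := rfl

lemma coord_mem {Na No : ℕ} (ℓ : Fin Na → ℝ) {Z : State Na No} (hZ : Z ∈ stateSpace Na No) :
    coord ℓ Z ∈ optionSpace No := by
  change ∑ j, ∑ i, ℓ i * Z i j = 0
  rw [Finset.sum_comm]
  refine Finset.sum_eq_zero fun i _ => ?_
  have : ∑ j, Z i j = 0 := hZ i
  rw [← Finset.mul_sum, this, mul_zero]

lemma coord_act {Na No : ℕ} {M : Matrix (Fin Na) (Fin Na) ℝ} {ℓ : Fin Na → ℝ} {c : ℝ}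
    (hℓ : ℓ ᵥ* M = c • ℓ) (Z : State Na No) : coord ℓ (act M Z) = c • coord ℓ Z := by
  ext j
  have h := Matrix.dotProduct_mulVec ℓ M fun k => Z k j
  rw [hℓ, smul_dotProduct] at h
  exact h

lemma coord_projState {Na No : ℕ} (ℓ : Fin Na → ℝ) (Z : State Na No) :
    coord ℓ (projState Z) = P0 (coord ℓ Z) := by
  ext j
  simp only [coord_apply, projState_apply, P0, mul_sub, Finset.sum_sub_distrib]
  congr 1
  rw [Finset.sum_comm, Finset.mul_sum]
  refine Finset.sum_congr rfl fun k _ => ?_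
  rw [← Finset.mul_sum]
  ring

lemma abs_coord_le {Na No : ℕ} (ℓ : Fin Na → ℝ) {Z : State Na No} {r : ℝ} {j : Fin No}
    (h : ∀ i, |Z i j| ≤ r) : |coord ℓ Z j| ≤ (∑ i, |ℓ i|) * r := by
  rw [coord_apply, Finset.sum_mul]
  refine (Finset.abs_sum_le_sum_abs _ _).trans (Finset.sum_le_sum fun i _ => ?_)
  rw [abs_mul]
  exact mul_le_mul_of_nonneg_left (h i) (abs_nonneg _)

/-- The linear map `Z ↦ v ⊗ coord ℓ Z`. -/
def tensorCoord {Na No : ℕ} (v ℓ : Fin Na → ℝ) : State Na No →ₗ[ℝ] State Na No where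
  toFun Z := tensor v (coord ℓ Z)
  map_add' Y Z := by
    ext i j
    simp [tensor, mul_add]
  map_smul' c Z := by
    ext i j
    simp [tensor, mul_left_comm]

/-- The Jacobian acts on each option separately, so every column lies on the line `ℝ v`, and `ℓ`
reads off its coefficient. -/
lemma act_critical_eq_zero {Na No : ℕ} {B : Matrix (Fin Na) (Fin Na) ℝ} {d u c : ℝ}
    {v ℓ : Fin Na → ℝ} (hℓv : ℓ ⬝ᵥ v = 1) (hker : ∀ y, B *ᵥ y = c • y → ∃ t : ℝ, y = t • v)
    (hu : u ≠ 0) (huc : u * c = d) {Y : State Na No} (hY : act (-d • 1 + u • B) Y = 0) :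
    Y = tensor v (coord ℓ Y) := by
  have hcol : ∀ j, ∃ t : ℝ, (fun k => Y k j) = t • v := by
    intro j
    refine hker _ ?_
    ext i
    have h1 := congrFun (congrFun hY i) j
    rw [act_add, act_smul, act_smul, act_one] at h1
    have h2 : -d * Y i j + u * (B *ᵥ fun k => Y k j) i = 0 := h1
    have h3 : u * ((B *ᵥ fun k => Y k j) i) = u * (c * Y i j) := by
      rw [← mul_assoc, huc]
      linarith
    exact mul_left_cancel₀ hu h3
  ext i j
  obtain ⟨t, ht⟩ := hcol j
  have h1 : coord ℓ Y j = t := by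
    have : coord ℓ Y j = ℓ ⬝ᵥ fun k => Y k j := rfl
    rw [this, ht, dotProduct_smul, hℓv, smul_eq_mul, mul_one]
  have h2 : Y i j = t * v i := congrFun ht i
  rw [tensor, h1, h2, mul_comm]

lemma contDiff_field {Na No : ℕ} {S₁ S₂ : ℝ → ℝ} (hS₁ : IsSaturating S₁) (hS₂ : IsSaturating S₂)
    (P Q : Matrix (Fin Na) (Fin Na) ℝ) (d u : ℝ) :
    ContDiff ℝ 1 (field (No := No) S₁ S₂ P Q d u) := by
  have h1 : ContDiff ℝ 1 S₁ := hS₁.contDiff.of_le (by norm_num)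
  have h2 : ContDiff ℝ 1 S₂ := hS₂.contDiff.of_le (by norm_num)
  have happ : ∀ i j, ContDiff ℝ 1 fun Z : State Na No => Z i j := fun i j =>
    contDiff_pi.1 (contDiff_pi.1 contDiff_id i) j
  have hact : ∀ (M : Matrix (Fin Na) (Fin Na) ℝ) (i j),
      ContDiff ℝ 1 fun Z : State Na No => act M Z i j := fun M i j =>
    (happ i j).comp (LinearMap.toContinuousLinearMap (act (No := No) M)).contDiff
  refine (LinearMap.toContinuousLinearMap (projState (Na := Na) (No := No))).contDiff.comp
    (contDiff_pi.2 fun i => contDiff_pi.2 fun j => ?_)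
  exact (contDiff_const.mul (happ i j)).add
    (contDiff_const.mul ((h1.comp (hact P i j)).sub (h2.comp (hact Q i j))))

lemma field_mem {Na No : ℕ} (S₁ S₂ : ℝ → ℝ) (P Q : Matrix (Fin Na) (Fin Na) ℝ) (d u : ℝ)
    (Z : State Na No) : field S₁ S₂ P Q d u Z ∈ stateSpace Na No := projState_mem _

lemma exists_norm_field_sub_le {Na No : ℕ} {S₁ S₂ : ℝ → ℝ} (hS₁ : IsSaturating S₁)
    (hS₂ : IsSaturating S₂) (P Q : Matrix (Fin Na) (Fin Na) ℝ) (d : ℝ) {u : ℝ} (hu : 0 < u) :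
    ∃ K r : ℝ, 0 < K ∧ 0 < r ∧ ∀ Z ∈ stateSpace Na No, ‖Z‖ ≤ r →
      ‖field S₁ S₂ P Q d u Z - act (-d • 1 + u • (P - Q)) Z‖ ≤ K * ‖Z‖ ^ 2 := by
  obtain ⟨K, r, hK, hr, h⟩ := exists_norm_remainder_le (No := No) hS₁ hS₂ P Q
  refine ⟨u * K, r, by positivity, hr, fun Z hZ hZr => ?_⟩
  rw [field_eq_of_mem _ _ _ _ _ _ hZ, add_sub_cancel_left, norm_smul, Real.norm_of_nonneg hu.le,
    mul_assoc]
  exact mul_le_mul_of_nonneg_left (h Z hZr) hu.le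

/-- Equilibria close to the critical point are tangent to the kernel of the Jacobian. -/
lemma exists_norm_sub_tensor_coord_le {Na No : ℕ} {S₁ S₂ : ℝ → ℝ} (hS₁ : IsSaturating S₁)
    (hS₂ : IsSaturating S₂) {P Q : Matrix (Fin Na) (Fin Na) ℝ} {d u c : ℝ} {v ℓ : Fin Na → ℝ}
    (hℓv : ℓ ⬝ᵥ v = 1) (hker : ∀ y, (P - Q) *ᵥ y = c • y → ∃ t : ℝ, y = t • v)
    (hu : u ≠ 0) (huc : u * c = d) {η : ℝ} (hη : 0 < η) :
    ∃ ε > 0, ∀ (u' : ℝ) (Z : State Na No), |u' - u| < ε → ‖Z‖ < ε →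
      IsEquilibrium (field S₁ S₂ P Q d u') Z → ‖Z - tensor v (coord ℓ Z)‖ ≤ η * ‖Z‖ := by
  obtain ⟨C, hC, hT⟩ := exists_norm_le_mul_norm_of_ker_le
    (act (No := No) (-d • 1 + u • (P - Q))) (LinearMap.id - tensorCoord v ℓ) (fun Y hY => by
      rw [LinearMap.sub_apply, LinearMap.id_apply, sub_eq_zero]
      exact act_critical_eq_zero hℓv hker hu huc hY)
  obtain ⟨K, r, hK, hr, hR⟩ := exists_norm_remainder_le (No := No) hS₁ hS₂ P Q
  obtain ⟨b, hb, hB⟩ := exists_norm_act_le (No := No) (P - Q)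
  set D := C * (b + (|u| + 1) * K) with hD
  have hD0 : 0 < D := by positivity
  refine ⟨min (min 1 r) (η / D), lt_min (lt_min one_pos hr) (by positivity),
    fun u' Z hu' hZ hZe => ?_⟩
  set ε := min (min 1 r) (η / D) with hε
  have hε1 : ε ≤ 1 := (min_le_left _ _).trans (min_le_left _ _)
  have hεr : ε ≤ r := (min_le_left _ _).trans (min_le_right _ _)
  have hεD : D * ε ≤ η := by
    have : ε ≤ η / D := min_le_right _ _
    rw [le_div_iff₀ hD0] at this
    linarith
  have hε0 : 0 ≤ ε := (norm_nonneg Z).trans hZ.le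
  have heq := hZe.2
  rw [field_eq_of_mem _ _ _ _ _ _ hZe.1] at heq
  -- Rewritten equilibrium equation: the critical Jacobian at `Z` equals a parameter shift of size
  -- `|u' - u| * ‖Z‖` plus a quadratic term.
  have h1 : act (-d • 1 + u • (P - Q)) Z =
      (u - u') • act (P - Q) Z - u' • projState (remainder S₁ S₂ P Q Z) := by
    rw [← sub_zero (act (-d • 1 + u • (P - Q)) Z), ← heq]
    simp only [act_add, act_smul]
    module
  have hu'1 : |u'| ≤ |u| + 1 := by
    have := abs_sub_abs_le_abs_sub u' u
    linarith
  have h2 : ‖act (-d • 1 + u • (P - Q)) Z‖ ≤ (b + (|u| + 1) * K) * ε * ‖Z‖ := by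
    rw [h1]
    refine (norm_sub_le _ _).trans ?_
    rw [norm_smul, norm_smul, Real.norm_eq_abs, Real.norm_eq_abs, abs_sub_comm]
    have h3 : |u' - u| * ‖act (P - Q) Z‖ ≤ ε * (b * ‖Z‖) := by
      gcongr
      exact hB Z
    have h4 : |u'| * ‖projState (remainder S₁ S₂ P Q Z)‖ ≤ (|u| + 1) * (K * (ε * ‖Z‖)) := by
      gcongr
      refine (hR Z (hZ.le.trans hεr)).trans ?_
      rw [sq]
      gcongr
    linarith
  calc ‖Z - tensor v (coord ℓ Z)‖ ≤ C * ‖act (-d • 1 + u • (P - Q)) Z‖ := hT Z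
    _ ≤ C * ((b + (|u| + 1) * K) * ε * ‖Z‖) := by gcongr
    _ = D * ε * ‖Z‖ := by rw [hD]; ring
    _ ≤ η * ‖Z‖ := by gcongr

lemma steadyStateBifurcation_field {Na No : ℕ} (hNo : 2 ≤ No) {S₁ S₂ : ℝ → ℝ}
    (hS₁ : IsSaturating S₁) (hS₂ : IsSaturating S₂) {P Q : Matrix (Fin Na) (Fin Na) ℝ} {d c : ℝ}
    (hd : 0 < d) (hc : 0 < c) {v ℓ : Fin Na → ℝ}
    (hv : (P - Q) *ᵥ v = c • v) (hℓ : ℓ ᵥ* (P - Q) = c • ℓ) (hℓv : ℓ ⬝ᵥ v = 1)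
    (hker : ∀ y, (P - Q) *ᵥ y = c • y → ∃ t : ℝ, y = t • v)
    (hspec : ∀ ξ ∈ eigenvalues (P - Q), ξ.re ≤ c) :
    SteadyStateBifurcation (field (No := No) S₁ S₂ P Q d) (d / c) v := by
  have hu0 : 0 < d / c := by positivity
  have huc : d / c * c = d := div_mul_cancel₀ d hc.ne'
  have hspecJ : ∀ u, 0 < u → ∀ ξ ∈ eigenvalues (-d • 1 + u • (P - Q)), ξ.re ≤ -d + u * c :=
    fun u hu => eigenvalues_re_le_of_smul_one_add hu.ne' fun ξ hξ =>
      mul_le_mul_of_nonneg_left (hspec ξ hξ) hu.le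
  refine ⟨fun u hu hlt => ?_, fun u hlt => ?_, fun Y hY => ?_,
    exists_branch hNo hS₁ hS₂ hv hℓ hℓv hker hc.ne' hu0.ne' huc, fun η hη => ?_⟩
  · have hμ : -d + u * c < 0 := by
      rw [lt_div_iff₀ hc] at hlt
      linarith
    obtain ⟨K, r, hK, hr, hf⟩ := exists_norm_field_sub_le (No := No) hS₁ hS₂ P Q d hu
    obtain ⟨N, h, a, C, hh, ha, hC, hNa, hNC, hN⟩ := exists_seminorm_euler_step_le (No := No)
      (-d • 1 + u • (P - Q)) (c := -d + u * c) (ω := (-d + u * c) / 2) (by linarith) (hspecJ u hu)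
    exact locallyExpStable_of_linearization _ N hh ha hC hNa hNC hN (by linarith) hK hr hf
  · have hu : 0 < u := hu0.trans hlt
    have hμ : 0 < -d + u * c := by
      rw [div_lt_iff₀ hc] at hlt
      linarith
    obtain ⟨K, r, hK, hr, hf⟩ := exists_norm_field_sub_le (No := No) hS₁ hS₂ P Q d hu
    -- The rate must exceed the abscissa `μ` for the seminorm and stay below `2 * μ` for the
    -- quadratic error to be dominated; `3 / 2 * μ` does both.
    obtain ⟨N, h, a, C, hh, ha, hC, hNa, hNC, hN⟩ := exists_seminorm_euler_step_le (No := No)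
      (-d • 1 + u • (P - Q)) (c := -d + u * c) (ω := 3 / 2 * (-d + u * c)) (by linarith)
      (hspecJ u hu)
    have he0 : tensor v (axial No) ≠ 0 := by
      intro h0
      have hv0 : v = 0 := by
        ext i
        have h4 : v i * axial No ⟨1, hNo⟩ = 0 := congrFun (congrFun h0 i) ⟨1, hNo⟩
        simpa [axial] using h4
      rw [hv0, dotProduct_zero] at hℓv
      exact zero_ne_one hℓv
    have hne : ‖tensor v (axial No)‖ ≠ 0 := norm_ne_zero_iff.2 he0
    have hLe : act (-d • 1 + u • (P - Q)) (tensor v (axial No)) =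
        (-d + u * c) • tensor v (axial No) := by
      rw [act_add, act_smul, act_smul, act_one, act_tensor hv]
      module
    refine not_lyapunovStable_of_linearization _ N (μ := -d + u * c)
      (e := ‖tensor v (axial No)‖⁻¹ • tensor v (axial No)) hh ha hC hNa hNC hN hμ (by linarith) hK
      hr hf (contDiff_field hS₁ hS₂ P Q d u) (field_mem S₁ S₂ P Q d u) ?_ ?_ ?_
    · exact fun i => (optionSpace No).smul_mem _ (tensor_mem v (axial_mem (by omega)) i)
    · rw [norm_smul, norm_inv, norm_norm, inv_mul_cancel₀ hne]
    · rw [map_smul, hLe, smul_comm]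
  · rw [(hasFDerivAt_field hS₁ hS₂ P Q d (d / c)).fderiv]
    change projState (act (-d • 1 + (d / c) • (P - Q)) Y) = 0 ↔ _
    rw [projState_eq_self (act_mem _ hY)]
    constructor
    · intro h
      exact ⟨coord ℓ Y, coord_mem ℓ hY, act_critical_eq_zero hℓv hker hu0.ne' huc h⟩
    · rintro ⟨w, -, rfl⟩
      rw [act_add, act_smul, act_smul, act_one, act_tensor hv, smul_smul, huc]
      module
  · obtain ⟨ε, hε, h⟩ := exists_norm_sub_tensor_coord_le (No := No) hS₁ hS₂ hℓv hker hu0.ne' huc hη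
    exact ⟨ε, hε, fun u Z hu hZ hZe => ⟨coord ℓ Z, coord_mem ℓ hZe.1, h u Z hu hZ hZe⟩⟩

/-! ### Signs of the equilibria near the bifurcation point -/

lemma nearbyBranches_of_near {Na No : ℕ} {Pr : State Na No → Prop}
    {f : ℝ → State Na No → State Na No} {ustar : ℝ}
    (h : ∃ ε > 0, ∀ u Z, |u - ustar| < ε → ‖Z‖ < ε → Z ≠ 0 → IsEquilibrium (f u) Z → Pr Z) :
    NearbyBranches Pr f ustar := by
  refine ⟨fun s₀ U Z hb => ?_, h⟩
  obtain ⟨ε, hε, h⟩ := h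
  have h0 : (0 : ℝ) ∈ Set.Ico 0 s₀ := ⟨le_rfl, hb.pos⟩
  have hU := hb.contU 0 h0
  have hZ := hb.contZ 0 h0
  rw [ContinuousWithinAt, hb.startU] at hU
  rw [ContinuousWithinAt, hb.startZ] at hZ
  have hle : 𝓝[>] (0 : ℝ) ≤ 𝓝[Set.Ico 0 s₀] 0 := by
    rw [nhdsWithin_Ico_eq_nhdsGE hb.pos]
    exact nhdsWithin_mono 0 Set.Ioi_subset_Ici_self
  filter_upwards [(hU.mono_left hle) (Metric.ball_mem_nhds ustar hε),
    (hZ.mono_left hle) (Metric.ball_mem_nhds 0 hε), Ioo_mem_nhdsGT hb.pos] with s h1 h2 h3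
  exact h (U s) (Z s) (by simpa [Real.dist_eq] using h1) (by simpa using h2)
    (hb.equilibrium s h3).1 (hb.equilibrium s h3).2

lemma exists_norm_le_abs_of_near_tensor {Na No : ℕ} {Z : State Na No} {v : Fin Na → ℝ}
    {w : Fin No → ℝ} {M : ℝ} (hv : ∀ i, |v i| ≤ M) (hZ0 : Z ≠ 0)
    (h : ‖Z - tensor v w‖ ≤ ‖Z‖ / 2) : ∃ j, ‖Z‖ ≤ 2 * M * |w j| := by
  by_contra! hcon
  have hpos : 0 < ‖Z‖ := norm_pos_iff.2 hZ0
  refine lt_irrefl ‖Z‖ ((pi_norm_lt_iff hpos).2 fun i => (pi_norm_lt_iff hpos).2 fun j => ?_)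
  have h1 := (abs_apply_le_norm (Z - tensor v w) i j).trans h
  have h2 : |Z i j - v i * w j| ≤ ‖Z‖ / 2 := h1
  have h3 : |v i * w j| ≤ M * |w j| := by
    rw [abs_mul]
    exact mul_le_mul_of_nonneg_right (hv i) (abs_nonneg _)
  have h4 := abs_sub_abs_le_abs_sub (Z i j) (v i * w j)
  have h5 := hcon j
  rw [Real.norm_eq_abs]
  linarith

lemma sign_eq_of_abs_sub_lt {x y : ℝ} (h : |x - y| < |y|) :
    SignType.sign x = SignType.sign y := by
  rw [abs_lt] at h
  rcases lt_trichotomy y 0 with hy | rfl | hy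
  · rw [abs_of_neg hy] at h
    rw [sign_neg hy, sign_neg (by linarith)]
  · simp at h
    linarith
  · rw [abs_of_pos hy] at h
    rw [sign_pos hy, sign_pos (by linarith)]

/-- If the kernel vector has entries of both signs, all equilibria close to the bifurcation point
are disagreement states. -/
lemma nearbyBranches_isDisagreement {Na No : ℕ} {S₁ S₂ : ℝ → ℝ} (hS₁ : IsSaturating S₁)
    (hS₂ : IsSaturating S₂) {P Q : Matrix (Fin Na) (Fin Na) ℝ} {d u c : ℝ} {v ℓ : Fin Na → ℝ}
    (hℓv : ℓ ⬝ᵥ v = 1) (hker : ∀ y, (P - Q) *ᵥ y = c • y → ∃ t : ℝ, y = t • v)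
    (hu : u ≠ 0) (huc : u * c = d) {i k : Fin Na} (hi : v i < 0) (hk : 0 < v k) :
    NearbyBranches (No := No) IsDisagreement (field S₁ S₂ P Q d) u := by
  have hM : ∀ i, |v i| ≤ ‖v‖ := norm_le_pi_norm v
  have hM0 : 0 < ‖v‖ := hk.trans_le ((le_abs_self _).trans (hM k))
  set m := min (-v i) (v k) with hm
  have hm0 : 0 < m := lt_min (by linarith) hk
  have hmi : m ≤ |v i| := by rw [abs_of_neg hi]; exact min_le_left _ _
  have hmk : m ≤ |v k| := by rw [abs_of_pos hk]; exact min_le_right _ _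
  -- The bound `1 / 2` produces an option `j` with `‖Z‖ ≤ 2 * ‖v‖ * |w j|`; then `m / (4 * ‖v‖)`
  -- keeps the error below half of `m * |w j|`, so the signs at agents `i` and `k` are those of `v ⊗
  -- w`.
  obtain ⟨ε, hε, h⟩ := exists_norm_sub_tensor_coord_le (No := No) hS₁ hS₂ hℓv hker hu huc
    (η := min (1 / 2) (m / (4 * ‖v‖))) (lt_min (by norm_num) (by positivity))
  refine nearbyBranches_of_near ⟨ε, hε, fun u' Z hu' hZ hZ0 hZe => ?_⟩
  have hη := h u' Z hu' hZ hZe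
  have hpos : 0 < ‖Z‖ := norm_pos_iff.2 hZ0
  obtain ⟨j, hj⟩ := exists_norm_le_abs_of_near_tensor hM hZ0 (hη.trans (by
    have := min_le_left (1 / 2) (m / (4 * ‖v‖))
    nlinarith))
  set w := coord ℓ Z
  have hw0 : 0 < |w j| := by
    by_contra h0
    have : |w j| = 0 := le_antisymm (not_lt.1 h0) (abs_nonneg _)
    rw [this, mul_zero] at hj
    linarith
  have hsmall : min (1 / 2) (m / (4 * ‖v‖)) * ‖Z‖ < m * |w j| := by
    calc _ ≤ m / (4 * ‖v‖) * (2 * ‖v‖ * |w j|) := by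
          gcongr
          exact min_le_right _ _
      _ = m * |w j| / 2 := by field_simp; ring
      _ < m * |w j| := half_lt_self (by positivity)
  have hsign : ∀ a, m ≤ |v a| →
      SignType.sign (Z a j) = SignType.sign (v a) * SignType.sign (w j) := by
    intro a ha
    rw [← sign_mul]
    refine sign_eq_of_abs_sub_lt ?_
    calc |Z a j - v a * w j| ≤ ‖Z - tensor v w‖ := abs_apply_le_norm (Z - tensor v w) a j
      _ ≤ _ := hη
      _ < m * |w j| := hsmall
      _ ≤ |v a| * |w j| := by gcongr
      _ = |v a * w j| := (abs_mul _ _).symm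
  refine ⟨i, k, ?_, j, ?_⟩
  · rintro rfl
    exact lt_asymm hi hk
  · rw [hsign i hmi, hsign k hmk, sign_neg hi, sign_pos hk]
    rcases lt_or_gt_of_ne (abs_pos.1 hw0) with h1 | h1
    · rw [sign_neg h1]; decide
    · rw [sign_pos h1]; decide

/-- If the kernel vector is positive and the kernel coordinates of equilibria close to the
bifurcation point are bounded away from zero, these equilibria are agreement states. -/
lemma nearbyBranches_isAgreement_of_coord {Na No : ℕ} {S₁ S₂ : ℝ → ℝ} (hS₁ : IsSaturating S₁)
    (hS₂ : IsSaturating S₂) {P Q : Matrix (Fin Na) (Fin Na) ℝ} {d u c : ℝ} {v ℓ : Fin Na → ℝ}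
    (hℓv : ℓ ⬝ᵥ v = 1) (hker : ∀ y, (P - Q) *ᵥ y = c • y → ∃ t : ℝ, y = t • v)
    (hu : u ≠ 0) (huc : u * c = d) (hv : ∀ i, 0 < v i) {θ ε : ℝ} (hθ : 0 < θ) (hε : 0 < ε)
    (hcoord : ∀ (u' : ℝ) (Z : State Na No), |u' - u| < ε → ‖Z‖ < ε → Z ≠ 0 →
      IsEquilibrium (field S₁ S₂ P Q d u') Z → ∀ j, θ * ‖Z‖ ≤ |coord ℓ Z j|) :
    NearbyBranches (No := No) IsAgreement (field S₁ S₂ P Q d) u := by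
  obtain ⟨m, hm0, hm⟩ : ∃ m, 0 < m ∧ ∀ i, m ≤ v i := by
    rcases isEmpty_or_nonempty (Fin Na) with hN | hN
    · exact ⟨1, one_pos, fun i => isEmptyElim i⟩
    · obtain ⟨i, -, hi⟩ := Finset.exists_min_image Finset.univ v Finset.univ_nonempty
      exact ⟨v i, hv i, fun k => hi k (Finset.mem_univ k)⟩
  obtain ⟨ε', hε', h⟩ := exists_norm_sub_tensor_coord_le (No := No) hS₁ hS₂ hℓv hker hu huc
    (η := m * θ / 2) (by positivity)
  refine nearbyBranches_of_near ⟨min ε ε', lt_min hε hε', fun u' Z hu' hZ hZ0 hZe => ?_⟩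
  have hη := h u' Z (hu'.trans_le (min_le_right _ _)) (hZ.trans_le (min_le_right _ _)) hZe
  have hw := hcoord u' Z (hu'.trans_le (min_le_left _ _)) (hZ.trans_le (min_le_left _ _)) hZ0 hZe
  have hpos : 0 < ‖Z‖ := norm_pos_iff.2 hZ0
  have hsign : ∀ i j, SignType.sign (Z i j) = SignType.sign (coord ℓ Z j) := by
    intro i j
    have h1 : SignType.sign (Z i j) = SignType.sign (v i * coord ℓ Z j) := by
      refine sign_eq_of_abs_sub_lt ?_
      calc |Z i j - v i * coord ℓ Z j| ≤ ‖Z - tensor v (coord ℓ Z)‖ :=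
            abs_apply_le_norm (Z - tensor v (coord ℓ Z)) i j
        _ ≤ m * θ / 2 * ‖Z‖ := hη
        _ < m * (θ * ‖Z‖) := by
          have : 0 < m * θ * ‖Z‖ := by positivity
          linarith
        _ ≤ v i * |coord ℓ Z j| := by
          have := hm i
          have := hw j
          have := (hv i).le
          gcongr
        _ = |v i * coord ℓ Z j| := by rw [abs_mul, abs_of_pos (hv i)]
    rw [h1, sign_mul, sign_pos (hv i), one_mul]
  intro i k j
  rw [hsign i j, hsign k j]

/-- For two options, equilibria close to the bifurcation point are agreement states. -/
lemma nearbyBranches_isAgreement_two {Na : ℕ} {S₁ S₂ : ℝ → ℝ} (hS₁ : IsSaturating S₁)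
    (hS₂ : IsSaturating S₂) {P Q : Matrix (Fin Na) (Fin Na) ℝ} {d u c : ℝ} {v ℓ : Fin Na → ℝ}
    (hℓv : ℓ ⬝ᵥ v = 1) (hker : ∀ y, (P - Q) *ᵥ y = c • y → ∃ t : ℝ, y = t • v)
    (hu : u ≠ 0) (huc : u * c = d) (hv : ∀ i, 0 < v i) :
    NearbyBranches (No := 2) IsAgreement (field S₁ S₂ P Q d) u := by
  obtain ⟨ε, hε, h⟩ := exists_norm_sub_tensor_coord_le (No := 2) hS₁ hS₂ hℓv hker hu huc
    (η := 1 / 2) (by norm_num)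
  refine nearbyBranches_isAgreement_of_coord hS₁ hS₂ hℓv hker hu huc hv
    (θ := 1 / (2 * (‖v‖ + 1))) (by positivity) hε fun u' Z hu' hZ hZ0 hZe j => ?_
  obtain ⟨k, hk⟩ := exists_norm_le_abs_of_near_tensor (M := ‖v‖ + 1)
    (fun i => (norm_le_pi_norm v i).trans (by linarith)) hZ0
    ((h u' Z hu' hZ hZe).trans (by linarith))
  have hsum : coord ℓ Z 0 + coord ℓ Z 1 = 0 := by
    have : ∑ j, coord ℓ Z j = 0 := coord_mem ℓ hZe.1
    rwa [Fin.sum_univ_two] at this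
  have habs : |coord ℓ Z k| = |coord ℓ Z j| := by
    have h01 : |coord ℓ Z 0| = |coord ℓ Z 1| := by
      rw [eq_neg_of_add_eq_zero_left hsum, abs_neg]
    fin_cases k <;> fin_cases j <;> simp [h01]
  rw [habs] at hk
  rw [one_div, inv_mul_le_iff₀ (by positivity)]
  exact hk

lemma P0_add {No : ℕ} (x y : Fin No → ℝ) : P0 (x + y) = P0 x + P0 y := by
  ext j
  simp only [P0, Pi.add_apply, Finset.sum_add_distrib]
  ring

lemma P0_smul {No : ℕ} (c : ℝ) (y : Fin No → ℝ) : P0 (c • y) = c • P0 y := by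
  ext j
  simp only [P0, Pi.smul_apply, smul_eq_mul, ← Finset.mul_sum]
  ring

/-- Second-order expansion of the nonlinear part of the drive near the kernel direction. -/
lemma remainder_near_tensor {Na No : ℕ} {S₁ S₂ : ℝ → ℝ} (hS₁ : IsSaturating S₁)
    (hS₂ : IsSaturating S₂) {P Q : Matrix (Fin Na) (Fin Na) ℝ} {v : Fin Na → ℝ} {p q : ℝ}
    (hP : P *ᵥ v = p • v) (hQ : Q *ᵥ v = q • v) {η : ℝ} (hη : 0 < η) :
    ∃ r > 0, ∀ (Z : State Na No) (w : Fin No → ℝ), ‖Z‖ ≤ r → ‖Z - tensor v w‖ ≤ r * ‖Z‖ → ∀ i j,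
      |remainder S₁ S₂ P Q Z i j - (iteratedDeriv 2 S₁ 0 / 2 * p ^ 2 -
        iteratedDeriv 2 S₂ 0 / 2 * q ^ 2) * (v i * w j) ^ 2| ≤ η * ‖Z‖ ^ 2 := by
  obtain ⟨r, hr, h⟩ := remainder_taylor (No := No) hS₁ hS₂ P Q (η := η / 2) (by positivity)
  obtain ⟨C₁, hC₁, hPC⟩ := exists_norm_act_le (No := No) P
  obtain ⟨C₂, hC₂, hQC⟩ := exists_norm_act_le (No := No) Q
  set b₁ := iteratedDeriv 2 S₁ 0 / 2
  set b₂ := iteratedDeriv 2 S₂ 0 / 2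
  -- Difference of squares: one factor is `M` applied to the deviation from `v ⊗ w`, hence small,
  -- and the other is of order `‖Z‖`.
  have hsq : ∀ (M : Matrix (Fin Na) (Fin Na) ℝ) (m C ρ : ℝ), M *ᵥ v = m • v → 0 < C → ρ ≤ 1 →
      (∀ Z : State Na No, ‖act M Z‖ ≤ C * ‖Z‖) → ∀ (Z : State Na No) (w : Fin No → ℝ),
      ‖Z - tensor v w‖ ≤ ρ * ‖Z‖ → ∀ i j,
      |act M Z i j ^ 2 - m ^ 2 * (v i * w j) ^ 2| ≤ 3 * C ^ 2 * ρ * ‖Z‖ ^ 2 := by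
    intro M m C ρ hM hC hρ hMC Z w hZ i j
    have h1 : act M Z i j - m * (v i * w j) = act M (Z - tensor v w) i j := by
      rw [map_sub, act_tensor hM]
      rfl
    have h2 : |act M Z i j - m * (v i * w j)| ≤ C * (ρ * ‖Z‖) := by
      rw [h1]
      refine (abs_apply_le_norm _ i j).trans ((hMC _).trans ?_)
      gcongr
    have h3 : |act M Z i j| ≤ C * ‖Z‖ := (abs_apply_le_norm _ i j).trans (hMC Z)
    have h4 : |act M Z i j + m * (v i * w j)| ≤ 3 * C * ‖Z‖ := by
      have h5 : act M Z i j + m * (v i * w j) =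
          2 * act M Z i j - (act M Z i j - m * (v i * w j)) := by ring
      rw [h5]
      refine (abs_sub _ _).trans ?_
      rw [abs_mul, abs_two]
      have h6 : C * (ρ * ‖Z‖) ≤ C * ‖Z‖ := by
        have := mul_le_mul_of_nonneg_right hρ (norm_nonneg Z)
        rw [one_mul] at this
        gcongr
      linarith
    have h7 : act M Z i j ^ 2 - m ^ 2 * (v i * w j) ^ 2 =
        (act M Z i j - m * (v i * w j)) * (act M Z i j + m * (v i * w j)) := by ring
    rw [h7, abs_mul]
    calc _ ≤ C * (ρ * ‖Z‖) * (3 * C * ‖Z‖) :=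
          mul_le_mul h2 h4 (abs_nonneg _) ((abs_nonneg _).trans h2)
      _ = _ := by ring
  set D := |b₁| * (3 * C₁ ^ 2) + |b₂| * (3 * C₂ ^ 2) + 1 with hD
  have hD0 : 0 < D := by positivity
  set ρ := min (min 1 r) (η / (2 * D)) with hρ
  have hρ0 : 0 < ρ := lt_min (lt_min one_pos hr) (by positivity)
  have hρ1 : ρ ≤ 1 := (min_le_left _ _).trans (min_le_left _ _)
  have hρr : ρ ≤ r := (min_le_left _ _).trans (min_le_right _ _)
  have hρD : D * ρ ≤ η / 2 := by
    have : ρ ≤ η / (2 * D) := min_le_right _ _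
    rw [le_div_iff₀ (by positivity)] at this
    linarith
  refine ⟨ρ, hρ0, fun Z w hZ hZw i j => ?_⟩
  have e₀ := h Z (hZ.trans hρr) i j
  have e₁ := hsq P p C₁ ρ hP hC₁ hρ1 hPC Z w hZw i j
  have e₂ := hsq Q q C₂ ρ hQ hC₂ hρ1 hQC Z w hZw i j
  have f₁ : |b₁ * (act P Z i j ^ 2 - p ^ 2 * (v i * w j) ^ 2)| ≤
      |b₁| * (3 * C₁ ^ 2 * ρ * ‖Z‖ ^ 2) := by
    rw [abs_mul]
    gcongr
  have f₂ : |b₂ * (act Q Z i j ^ 2 - q ^ 2 * (v i * w j) ^ 2)| ≤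
      |b₂| * (3 * C₂ ^ 2 * ρ * ‖Z‖ ^ 2) := by
    rw [abs_mul]
    gcongr
  have hDZ : D * ρ * ‖Z‖ ^ 2 ≤ η / 2 * ‖Z‖ ^ 2 := by gcongr
  have hρZ : 0 ≤ ρ * ‖Z‖ ^ 2 := by positivity
  rw [hD] at hDZ
  rw [abs_le] at e₀ f₁ f₂ ⊢
  constructor <;> nlinarith

/-- The reduced bifurcation equation on the kernel, up to terms of higher than second order. -/
lemma reduced_equation {Na No : ℕ} {S₁ S₂ : ℝ → ℝ} (hS₁ : IsSaturating S₁)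
    (hS₂ : IsSaturating S₂) {P Q : Matrix (Fin Na) (Fin Na) ℝ} {d u c p q : ℝ} {v ℓ : Fin Na → ℝ}
    (hℓ : ℓ ᵥ* (P - Q) = c • ℓ) (hℓv : ℓ ⬝ᵥ v = 1)
    (hker : ∀ y, (P - Q) *ᵥ y = c • y → ∃ t : ℝ, y = t • v) (hu : u ≠ 0) (huc : u * c = d)
    (hP : P *ᵥ v = p • v) (hQ : Q *ᵥ v = q • v) {η : ℝ} (hη : 0 < η) :
    ∃ ε > 0, ∀ (u' : ℝ) (Z : State Na No), |u' - u| < ε → ‖Z‖ < ε →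
      IsEquilibrium (field S₁ S₂ P Q d u') Z → ∀ j,
      |(-d + u' * c) * coord ℓ Z j + u' * ((iteratedDeriv 2 S₁ 0 / 2 * p ^ 2 -
        iteratedDeriv 2 S₂ 0 / 2 * q ^ 2) * (∑ i, ℓ i * v i ^ 2) *
          P0 (fun j => coord ℓ Z j ^ 2) j)| ≤ η * ‖Z‖ ^ 2 := by
  set κ := iteratedDeriv 2 S₁ 0 / 2 * p ^ 2 - iteratedDeriv 2 S₂ 0 / 2 * q ^ 2 with hκ
  set Λ := ∑ i, |ℓ i| with hΛ
  have hΛ0 : 0 ≤ Λ := Finset.sum_nonneg fun i _ => abs_nonneg _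
  set D := (|u| + 1) * (2 * (Λ + 1)) with hD
  have hD0 : 0 < D := by positivity
  obtain ⟨r, hr, hR⟩ := remainder_near_tensor (No := No) hS₁ hS₂ hP hQ (η := η / D) (by positivity)
  obtain ⟨ε, hε, h⟩ := exists_norm_sub_tensor_coord_le (No := No) hS₁ hS₂ hℓv hker hu huc hr
  refine ⟨min ε (min r 1), lt_min hε (lt_min hr one_pos), fun u' Z hu' hZ hZe j => ?_⟩
  have hu'1 : |u'| ≤ |u| + 1 := by
    have h1 := abs_sub_abs_le_abs_sub u' u
    have h2 := hu'.le.trans ((min_le_right _ _).trans (min_le_right _ _))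
    linarith
  have hRZ := hR Z (coord ℓ Z) (hZ.le.trans ((min_le_right _ _).trans (min_le_left _ _)))
    (h u' Z (hu'.trans_le (min_le_left _ _)) (hZ.trans_le (min_le_left _ _)) hZe)
  set w := coord ℓ Z with hw
  let X : State Na No := fun i j => remainder S₁ S₂ P Q Z i j - κ * (v i * w j) ^ 2
  have hX : coord ℓ (remainder S₁ S₂ P Q Z) =
      coord ℓ X + (κ * ∑ i, ℓ i * v i ^ 2) • fun j => w j ^ 2 := by
    ext j
    simp only [coord_apply, X, Pi.add_apply, Pi.smul_apply, smul_eq_mul, Finset.mul_sum,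
      Finset.sum_mul, ← Finset.sum_add_distrib]
    exact Finset.sum_congr rfl fun i _ => by ring
  -- Pairing with the left eigenvector turns the linear part into a scalar multiple of `w` exactly,
  -- without any error from the component off the kernel.
  have heq : coord ℓ (field S₁ S₂ P Q d u' Z) j = 0 := by
    rw [hZe.2, map_zero]
    rfl
  rw [field_eq_of_mem _ _ _ _ _ _ hZe.1, act_add, act_smul, act_smul, act_one, map_add, map_add,
    map_smul, map_smul, map_smul, coord_act hℓ, coord_projState, hX, P0_add, P0_smul] at heq
  have heq' : (-d + u' * c) * w j + u' * (κ * (∑ i, ℓ i * v i ^ 2) * P0 (fun j => w j ^ 2) j) =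
      -(u' * P0 (coord ℓ X) j) := by
    simp only [Pi.add_apply, Pi.smul_apply, smul_eq_mul] at heq
    rw [← hw] at heq
    linarith
  rw [heq', abs_neg, abs_mul]
  have h1 : |P0 (coord ℓ X) j| ≤ 2 * (Λ * (η / D * ‖Z‖ ^ 2)) :=
    abs_P0_le (fun l => abs_coord_le ℓ fun i => hRZ i l) j
  calc |u'| * |P0 (coord ℓ X) j| ≤ (|u| + 1) * (2 * (Λ * (η / D * ‖Z‖ ^ 2))) := by gcongr
    _ ≤ (|u| + 1) * (2 * ((Λ + 1) * (η / D * ‖Z‖ ^ 2))) := by gcongr; linarith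
    _ = D * (η / D) * ‖Z‖ ^ 2 := by rw [hD]; ring
    _ = η * ‖Z‖ ^ 2 := by rw [mul_div_cancel₀ _ hD0.ne']

/-- Solutions of a perturbed equation `σ w + k P0 (w ^ 2) = 0` have all entries of the order of
the largest one. -/
lemma le_abs_of_approx_quadratic {No : ℕ} {w : Fin No → ℝ} {σ k n Λ M η θ : ℝ} (hn : 0 < n)
    (hM : 0 < M) (hη1 : η ≤ 1)
    (hw : ∀ j, |w j| ≤ Λ * n) (hmax : ∃ j, n ≤ 2 * M * |w j|)
    (heq : ∀ j, |σ * w j + k * P0 (fun j => w j ^ 2) j| ≤ η * n ^ 2) (hθ0 : 0 ≤ θ) (hθ1 : θ ≤ 1)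
    (hsmall : η + θ * (2 * M * (1 + 2 * |k| * Λ ^ 2) + |k|) < |k| / (4 * M ^ 2 * No))
    (j : Fin No) : θ * n ≤ |w j| := by
  by_contra! hj
  have hNo : (0 : ℝ) < No := by exact_mod_cast (Fin.pos_iff_nonempty.2 ⟨j⟩)
  obtain ⟨l, hl⟩ := hmax
  set m := 1 / (No : ℝ) * ∑ l, w l ^ 2 with hm
  have hP0 : ∀ j, P0 (fun j => w j ^ 2) j = w j ^ 2 - m := fun j => rfl
  have hm1 : n ^ 2 / (4 * M ^ 2 * No) ≤ m := by
    have h1 : w l ^ 2 ≤ ∑ l, w l ^ 2 :=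
      Finset.single_le_sum (f := fun l => w l ^ 2) (fun i _ => sq_nonneg _) (Finset.mem_univ l)
    have h2 : n ^ 2 ≤ (2 * M * |w l|) ^ 2 := by gcongr
    rw [mul_pow, sq_abs] at h2
    have h3 : m = (∑ l, w l ^ 2) / No := by rw [hm]; ring
    rw [h3, div_le_div_iff₀ (by positivity) hNo]
    have h4 : (2 * M) ^ 2 * w l ^ 2 ≤ (2 * M) ^ 2 * ∑ l, w l ^ 2 := by gcongr
    nlinarith
  have hP0l : |P0 (fun j => w j ^ 2) l| ≤ 2 * (Λ * n) ^ 2 := by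
    refine abs_P0_le (fun i => ?_) l
    rw [abs_pow]
    have := hw i
    gcongr
  -- The equation at a coordinate of order `n` shows that `σ`, the eigenvalue offset, is itself
  -- `O(n)`.
  have hσ : |σ| ≤ 2 * M * (1 + 2 * |k| * Λ ^ 2) * n := by
    have h1 : |σ * w l| ≤ η * n ^ 2 + |k| * (2 * (Λ * n) ^ 2) := by
      have h2 : σ * w l = (σ * w l + k * P0 (fun j => w j ^ 2) l) -
          k * P0 (fun j => w j ^ 2) l := by ring
      rw [h2]
      refine (abs_sub _ _).trans (add_le_add (heq l) ?_)
      rw [abs_mul]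
      gcongr
    rw [abs_mul] at h1
    have h3 : |σ| * n ≤ |σ| * (2 * M * |w l|) := by gcongr
    have h4 : η * n ^ 2 ≤ 1 * n ^ 2 := by gcongr
    have h5 : |σ| * n ≤ 2 * M * (1 + 2 * |k| * Λ ^ 2) * n * n := by nlinarith
    exact le_of_mul_le_mul_right h5 hn
  -- At the small coordinate `j` nothing of comparable size balances `k * m`, whereas the mean
  -- square `m` is of order `n ^ 2`.
  have h1 : |k| * m ≤ η * n ^ 2 + |σ| * |w j| + |k| * |w j| ^ 2 := by
    have hm0 : 0 ≤ m := le_trans (by positivity) hm1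
    have h2 : k * m = -(σ * w j + k * P0 (fun j => w j ^ 2) j) + σ * w j + k * w j ^ 2 := by
      rw [hP0]
      ring
    calc |k| * m = |k * m| := by rw [abs_mul, abs_of_nonneg hm0]
      _ ≤ |-(σ * w j + k * P0 (fun j => w j ^ 2) j)| + |σ * w j| + |k * w j ^ 2| := by
        rw [h2]
        exact (abs_add_le _ _).trans (add_le_add (abs_add_le _ _) le_rfl)
      _ ≤ _ := by
        rw [abs_neg, abs_mul σ, abs_mul k, abs_pow]
        have := heq j
        gcongr
  have h2 : |σ| * |w j| ≤ 2 * M * (1 + 2 * |k| * Λ ^ 2) * n * (θ * n) := by gcongr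
  have h3 : |k| * |w j| ^ 2 ≤ |k| * (θ * n ^ 2) := by
    gcongr
    calc |w j| ^ 2 ≤ (θ * n) ^ 2 := by gcongr
      _ = θ * θ * n ^ 2 := by ring
      _ ≤ 1 * θ * n ^ 2 := by gcongr
      _ = θ * n ^ 2 := by ring
  have h4 : |k| * (n ^ 2 / (4 * M ^ 2 * No)) ≤ |k| * m := by gcongr
  have h5 : (η + θ * (2 * M * (1 + 2 * |k| * Λ ^ 2) + |k|)) * n ^ 2 <
      |k| / (4 * M ^ 2 * No) * n ^ 2 := by gcongr
  have h6 : |k| * (n ^ 2 / (4 * M ^ 2 * No)) = |k| / (4 * M ^ 2 * No) * n ^ 2 := by ring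
  nlinarith

/-- Under the genericity condition on the second-order terms, equilibria close to the bifurcation
point are agreement states. -/
lemma nearbyBranches_isAgreement_of_generic {Na No : ℕ} (hNo : 0 < No) {S₁ S₂ : ℝ → ℝ}
    (hS₁ : IsSaturating S₁) (hS₂ : IsSaturating S₂) {P Q : Matrix (Fin Na) (Fin Na) ℝ}
    {d u c p q : ℝ} {v ℓ : Fin Na → ℝ} (hℓ : ℓ ᵥ* (P - Q) = c • ℓ) (hℓv : ℓ ⬝ᵥ v = 1)
    (hker : ∀ y, (P - Q) *ᵥ y = c • y → ∃ t : ℝ, y = t • v) (hu : 0 < u) (huc : u * c = d)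
    (hP : P *ᵥ v = p • v) (hQ : Q *ᵥ v = q • v) (hv : ∀ i, 0 < v i) (hℓ0 : ∀ i, 0 < ℓ i)
    (hgen : iteratedDeriv 2 S₁ 0 * p ^ 2 ≠ iteratedDeriv 2 S₂ 0 * q ^ 2) :
    NearbyBranches (No := No) IsAgreement (field S₁ S₂ P Q d) u := by
  have hne : Nonempty (Fin Na) := by
    by_contra hempty
    rw [not_nonempty_iff] at hempty
    simp [dotProduct] at hℓv
  set κ := (iteratedDeriv 2 S₁ 0 / 2 * p ^ 2 - iteratedDeriv 2 S₂ 0 / 2 * q ^ 2) *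
    (∑ i, ℓ i * v i ^ 2) with hκ
  have hκ0 : 0 < |κ| := by
    refine abs_pos.2 (mul_ne_zero (fun h0 => hgen (by linarith)) ?_)
    exact (Finset.sum_pos (fun i _ => mul_pos (hℓ0 i) (pow_pos (hv i) 2))
      Finset.univ_nonempty).ne'
  have hM : ∀ i, |v i| ≤ ‖v‖ := norm_le_pi_norm v
  have hM0 : 0 < ‖v‖ := (hv hne.some).trans_le ((le_abs_self _).trans (hM _))
  set M := ‖v‖
  set Λ := ∑ i, |ℓ i| with hΛ
  -- The constants are uniform in `u'` with `|u' - u| < u / 2`: `k₀` uses a lower bound for `|u' *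
  -- κ|`, and `D` below an upper bound. Then `η` and `θ * D` take at most a quarter of `k₀` each.
  set k₀ := u / 2 * |κ| / (4 * M ^ 2 * No) with hk₀
  have hNo' : (0 : ℝ) < No := by exact_mod_cast hNo
  have hk₀0 : 0 < k₀ := by positivity
  set D := 2 * M * (1 + 2 * (2 * u * |κ|) * Λ ^ 2) + 2 * u * |κ| with hD
  have hD0 : 0 < D := by positivity
  set η := min 1 (k₀ / 4) with hη
  have hη0 : 0 < η := lt_min one_pos (by positivity)
  set θ := min 1 (k₀ / (4 * D)) with hθ
  have hθ0 : 0 < θ := lt_min one_pos (by positivity)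
  have hθD : θ * D ≤ k₀ / 4 := by
    have : θ ≤ k₀ / (4 * D) := min_le_right _ _
    rw [le_div_iff₀ (by positivity)] at this
    linarith
  obtain ⟨ε₁, hε₁, h₁⟩ := exists_norm_sub_tensor_coord_le (No := No) hS₁ hS₂ hℓv hker hu.ne' huc
    (η := 1 / 2) (by norm_num)
  obtain ⟨ε₂, hε₂, h₂⟩ := reduced_equation (No := No) hS₁ hS₂ hℓ hℓv hker hu.ne' huc hP hQ hη0
  refine nearbyBranches_isAgreement_of_coord hS₁ hS₂ hℓv hker hu.ne' huc hv hθ0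
    (ε := min (u / 2) (min ε₁ ε₂)) (lt_min (by positivity) (lt_min hε₁ hε₂))
    fun u' Z hu' hZ hZ0 hZe j => ?_
  have hle₁ : min (u / 2) (min ε₁ ε₂) ≤ ε₁ := (min_le_right _ _).trans (min_le_left _ _)
  have hle₂ : min (u / 2) (min ε₁ ε₂) ≤ ε₂ := (min_le_right _ _).trans (min_le_right _ _)
  have hu'2 := abs_lt.1 (hu'.trans_le (min_le_left _ _))
  have hu'0 : 0 < u' := by linarith
  have hk : |u' * κ| = u' * |κ| := by rw [abs_mul, abs_of_pos hu'0]
  have hk1 : u / 2 * |κ| ≤ |u' * κ| := by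
    rw [hk]
    gcongr
    linarith
  have hk2 : |u' * κ| ≤ 2 * u * |κ| := by
    rw [hk]
    gcongr
    linarith
  have hmax := exists_norm_le_abs_of_near_tensor hM hZ0
    ((h₁ u' Z (hu'.trans_le hle₁) (hZ.trans_le hle₁) hZe).trans (by linarith))
  refine le_abs_of_approx_quadratic (σ := -d + u' * c) (k := u' * κ) (η := η)
    (norm_pos_iff.2 hZ0) hM0 (min_le_left _ _)
    (fun l => abs_coord_le ℓ fun i => abs_apply_le_norm Z i l) hmax
    (fun l => ?_) hθ0.le (min_le_left _ _) ?_ j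
  · rw [mul_assoc]
    exact h₂ u' Z (hu'.trans_le hle₂) (hZ.trans_le hle₂) hZe l
  · have e1 : θ * (2 * M * (1 + 2 * |u' * κ| * Λ ^ 2) + |u' * κ|) ≤ θ * D := by
      rw [hD]
      gcongr
    have e2 : k₀ ≤ |u' * κ| / (4 * M ^ 2 * No) := by
      rw [hk₀]
      gcongr
    have e3 : η ≤ k₀ / 4 := min_le_right _ _
    linarith

/-! ### Transfer of spectral data from the adjacency matrix, and the theorem -/

lemma smul_one_add_mulVec {n : ℕ} {A : Matrix (Fin n) (Fin n) ℝ} {v : Fin n → ℝ} {r : ℝ}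
    (h : A *ᵥ v = r • v) (a g : ℝ) : (a • 1 + g • A) *ᵥ v = (a + g * r) • v := by
  rw [Matrix.add_mulVec, Matrix.smul_mulVec, Matrix.one_mulVec, Matrix.smul_mulVec, h]
  module

lemma vecMul_smul_one_add {n : ℕ} {A : Matrix (Fin n) (Fin n) ℝ} {v : Fin n → ℝ} {r : ℝ}
    (h : v ᵥ* A = r • v) (a g : ℝ) : v ᵥ* (a • 1 + g • A) = (a + g * r) • v := by
  rw [Matrix.vecMul_add, Matrix.vecMul_smul, Matrix.vecMul_one, Matrix.vecMul_smul, h]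
  module

lemma mulVec_of_smul_one_add_mulVec {n : ℕ} {A : Matrix (Fin n) (Fin n) ℝ} {y : Fin n → ℝ}
    {r a g : ℝ} (hg : g ≠ 0) (h : (a • 1 + g • A) *ᵥ y = (a + g * r) • y) : A *ᵥ y = r • y := by
  rw [Matrix.add_mulVec, Matrix.smul_mulVec, Matrix.one_mulVec, Matrix.smul_mulVec, add_smul,
    add_right_inj, mul_smul] at h
  exact smul_right_injective _ hg h

end OpinionDynamics

theorem corollary1 {Na No : ℕ} (hNo : 2 ≤ No) (S₁ S₂ : ℝ → ℝ)
    (hS₁ : IsSaturating S₁) (hS₂ : IsSaturating S₂)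
    (d α β γ δ : ℝ) (hd : 0 < d)
    (A : Matrix (Fin Na) (Fin Na) ℝ) (hA : IsAdjacency A) (hconn : StronglyConnected A) :
    -- A. Cooperative agents
    (∀ lmax : ℝ, IsGreatest (realParts A) lmax →
      0 < γ - δ → 0 < α - β + lmax * (γ - δ) →
      ∃ vmax : Fin Na → ℝ, (∀ i, 0 < vmax i) ∧ A *ᵥ vmax = lmax • vmax ∧
        SteadyStateBifurcation (No := No) (homField S₁ S₂ A d α β γ δ)
          (d / (α - β + lmax * (γ - δ))) vmax ∧
        ((No = 2 ∨ iteratedDeriv 2 S₁ 0 * (α + γ * lmax) ^ 2 ≠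
            iteratedDeriv 2 S₂ 0 * (β + δ * lmax) ^ 2) →
          NearbyBranches (No := No) IsAgreement (homField S₁ S₂ A d α β γ δ)
            (d / (α - β + lmax * (γ - δ))))) ∧
    -- B. Competitive agents
    (∀ (lmin : ℝ) (vmin : Fin Na → ℝ),
      IsLeast (realParts A) lmin → (lmin : ℂ) ∈ eigenvalues A →
      A.charpoly.rootMultiplicity lmin = 1 →
      (∀ ξ ∈ eigenvalues A, ξ ≠ (lmin : ℂ) → ξ.re ≠ lmin) →
      vmin ≠ 0 → A *ᵥ vmin = lmin • vmin →
      γ - δ < 0 → 0 < α - β + lmin * (γ - δ) →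
      SteadyStateBifurcation (No := No) (homField S₁ S₂ A d α β γ δ)
          (d / (α - β + lmin * (γ - δ))) vmin ∧
        ((∃ i, vmin i < 0) → (∃ k, 0 < vmin k) →
          NearbyBranches (No := No) IsDisagreement (homField S₁ S₂ A d α β γ δ)
            (d / (α - β + lmin * (γ - δ))))) := by

  have hA0 : ∀ i k, 0 ≤ A i k := fun i k => by
    rcases hA.zero_or_one i k with h | h <;> rw [h]
    exact zero_le_one
  have hB : (α • 1 + γ • A) - (β • 1 + δ • A) = (α - β) • 1 + (γ - δ) • A := by module
  rw [homField_eq_field (by omega) S₁ S₂ hA.diag]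
  refine ⟨fun lmax hl hg hc => ?_, fun lmin vmin hl _ hsimple _ hv0 hv hg hc => ?_⟩
  · obtain ⟨v, ℓ, hv, hℓ, hAv, hℓA, hℓv, hker⟩ := exists_perron_vectors hA0 hconn hl
    have hBv := smul_one_add_mulVec hAv (α - β) (γ - δ)
    have hℓB := vecMul_smul_one_add hℓA (α - β) (γ - δ)
    have hkerB : ∀ y, ((α - β) • 1 + (γ - δ) • A) *ᵥ y = (α - β + (γ - δ) * lmax) • y →
        ∃ t : ℝ, y = t • v := fun y hy => hker y (mulVec_of_smul_one_add_mulVec hg.ne' hy)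
    have hspec := eigenvalues_re_le_of_smul_one_add (a := α - β) (m := (γ - δ) * lmax) hg.ne'
      fun ξ hξ => mul_le_mul_of_nonneg_left (hl.2 ⟨ξ, hξ, rfl⟩) hg.le
    rw [mul_comm lmax] at hc ⊢
    rw [← hB] at hBv hℓB hkerB hspec
    have hu := div_pos hd hc
    have huc := div_mul_cancel₀ d hc.ne'
    refine ⟨v, hv, hAv, steadyStateBifurcation_field hNo hS₁ hS₂ hd hc hBv hℓB hℓv hkerB hspec, ?_⟩
    rintro (rfl | hgen)
    · exact nearbyBranches_isAgreement_two hS₁ hS₂ hℓv hkerB hu.ne' huc hv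
    · exact nearbyBranches_isAgreement_of_generic (by omega) hS₁ hS₂ hℓB hℓv hkerB hu huc
        (smul_one_add_mulVec hAv α γ) (smul_one_add_mulVec hAv β δ) hv hℓ hgen
  · obtain ⟨ℓ, hℓA, hℓv, hker⟩ := exists_left_eigenvector_of_simple hv0 hv hsimple
    have hBv := smul_one_add_mulVec hv (α - β) (γ - δ)
    have hℓB := vecMul_smul_one_add hℓA (α - β) (γ - δ)
    have hkerB : ∀ y, ((α - β) • 1 + (γ - δ) • A) *ᵥ y = (α - β + (γ - δ) * lmin) • y →
        ∃ t : ℝ, y = t • vmin := fun y hy => hker y (mulVec_of_smul_one_add_mulVec hg.ne hy)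
    -- Multiplication by the negative `γ - δ` reverses the order, so the smallest real part of `A`
    -- gives the spectral abscissa.
    have hspec := eigenvalues_re_le_of_smul_one_add (a := α - β) (m := (γ - δ) * lmin) hg.ne
      fun ξ hξ => mul_le_mul_of_nonpos_left (hl.2 ⟨ξ, hξ, rfl⟩) hg.le
    rw [mul_comm lmin] at hc ⊢
    rw [← hB] at hBv hℓB hkerB hspec
    have hu := div_pos hd hc
    have huc := div_mul_cancel₀ d hc.ne'
    refine ⟨steadyStateBifurcation_field hNo hS₁ hS₂ hd hc hBv hℓB hℓv hkerB hspec, ?_⟩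
    rintro ⟨i, hi⟩ ⟨k, hk⟩
    exact nearbyBranches_isDisagreement hS₁ hS₂ hℓv hkerB hu.ne' huc hi hk
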